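/- There are an infinite-dimensional separable real Hilbert space $H$ and a Gaussian measure $\gamma$ on $H$ with properties (1) and (2) below. They can be taken of Preiss's form: there are weights $\lambda_1\ge\lambda_2\ge\cdots>0$ with $\sum_i\lambda_i<\infty$ such that $H=\{x\in\mathbb R^{\mathbb N}:\sum_i\lambda_i x_i^2<\infty\}$ (up to a linear isometry) with the norm $\|x\|=(\sum_i\lambda_i x_i^2)^{1/2}$, and $\gamma$ is the restriction to $H$ of the standard Gaussian measure on $\mathbb R^{\mathbb N}$, the countable product of one-dimensional standard Gaussian measures. For $f\in L^1_{\mathrm{loc}}(\gamma)$ (real-valued), write $$M^cf(x)=\sup_{r>0}\frac1{\gamma(B(x,r))}\int_{B(x,r)}|f|\,d\gamma,\qquad Mf(x)=\sup_{B\ni x}\frac1{\gamma(B)}\int_{B}|f|\,d\gamma,$$ where $B(x,r)$ is the closed ball with centre $x$ and radius $r$, and the second supremum is over all closed balls $B$ of positive radius that contain $x$; both take values in $[0,\infty]$, and a quotient with zero denominator is read as $0$. (1) There is $f\in L^1_{\mathrm{loc}}(\gamma)$ such that $M^cf(x)<|f(x)|$ for all $x$ in some Borel set of positive $\gamma$-measure.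 (2) $M$ has no non-constant fixed point in $L^1_{\mathrm{loc}}(\gamma)$: if $f\in L^1_{\mathrm{loc}}(\gamma)$ and $Mf=f$ $\gamma$-almost everywhere, then $f$ is $\gamma$-almost everywhere equal to a constant. -/

import Mathlib

open MeasureTheory ProbabilityTheory Metric
open scoped ENNReal

/-- The centred Hardy–Littlewood maximal function: the supremum over `r > 0` of the averages of
`|f|` over the closed balls `B(x, r)`.  The average over a null ball is `0 / 0 = 0` in `ℝ≥0∞`. -/
noncomputable def centeredMaximal {X : Type*} [PseudoMetricSpace X] [MeasurableSpace X]
    (μ : Measure X) (f : X → ℝ) (x : X) : ℝ≥0∞ :=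
  ⨆ (r : ℝ) (_ : 0 < r), (∫⁻ y in closedBall x r, ‖f y‖ₑ ∂μ) / μ (closedBall x r)

/-- The uncentred Hardy–Littlewood maximal function: the supremum of the averages of `|f|` over
all closed balls `B(z, r)`, `r > 0`, that contain `x`. -/
noncomputable def uncenteredMaximal {X : Type*} [PseudoMetricSpace X] [MeasurableSpace X]
    (μ : Measure X) (f : X → ℝ) (x : X) : ℝ≥0∞ :=
  ⨆ (z : X) (r : ℝ) (_ : 0 < r) (_ : x ∈ closedBall z r),
    (∫⁻ y in closedBall z r, ‖f y‖ₑ ∂μ) / μ (closedBall z r)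

/-- `f` is a fixed point of the uncentred maximal operator: `M f = f` almost everywhere.  The
equation is read in the extended reals, so it forces `f` to be nonnegative almost everywhere. -/
def IsMaximalFixedPoint {X : Type*} [PseudoMetricSpace X] [MeasurableSpace X]
    (μ : Measure X) (f : X → ℝ) : Prop :=
  ∀ᵐ x ∂μ, ((uncenteredMaximal μ f x : ℝ≥0∞) : EReal) = ((f x : ℝ) : EReal)

/-- The standard Gaussian measure on `ℝ^ℕ`: the countable product of copies of `N(0, 1)`. -/
noncomputable def stdGaussianSeq : Measure (ℕ → ℝ) :=
  Measure.infinitePi (fun _ : ℕ => gaussianReal 0 1)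

/-- Via the linear map `T`, the space `H` is the linear subspace `{x : ∑ wᵢ xᵢ² < ∞}` of `ℝ^ℕ`
with the norm `(∑ wᵢ xᵢ²)^(1/2)`, where the weights `w₀ ≥ w₁ ≥ ⋯ > 0` are summable, and `γ` is the
restriction to it of the standard Gaussian measure of `ℝ^ℕ`, which is carried by this subspace. -/
structure IsWeightedGaussianSpace {H : Type*} [NormedAddCommGroup H] [InnerProductSpace ℝ H]
    [MeasurableSpace H] (γ : Measure H) (w : ℕ → ℝ) (T : H →ₗ[ℝ] (ℕ → ℝ)) : Prop where
  antitone : Antitone w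
  pos : ∀ i, 0 < w i
  summable : Summable w
  injective : Function.Injective T
  range_eq : Set.range T = {x : ℕ → ℝ | Summable fun i => w i * x i ^ 2}
  norm_eq : ∀ h : H, ‖h‖ = Real.sqrt (∑' i, w i * T h i ^ 2)
  measurable : Measurable T
  map_eq : γ.map T = stdGaussianSeq

/-! The weights are `4⁻ᵏ` on a block of `2 ^ k` coordinates. For (1), take `f` to be the indicator
of the set `A` of points whose sums of squares over all blocks `K ≥ K₀` are within 2% of `2 ^ K`;
Chebyshev and Borel–Cantelli give `A` positive measure for some `K₀`. Conditioning the Gaussian on a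
small ball about `x ∈ A` resembles tilting it by `exp (-θ ‖y - x‖² / 2)`, with `θ` a Lagrange
multiplier fixed by the radius. The tilted law is again a product of Gaussians. In the block with `4
^ K ≤ θ < 4 ^ (K + 1)`, put `σ = 1 / (1 + θ 4⁻ᴷ)`, which lies in `[1/5, 1/2]`. A tilted coordinate
has variance `σ` and mean `(1 - σ) xᵢ`, so its second moment averages about `σ + (1 - σ)² < 1` over
the block: the ball consists mostly of points too short in this block to be typical.

Quantitatively, the tilted measure gives `A` mass at most `exp (-2 ^ K / 1000)`
(`tiltedSeq_sum_sq_ge_le`), while replacing the ball by the tilt costs a factor `exp (2 D)` with `D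
= O(2 ^ (K / 2))` (`exists_stdGaussianSeq_inter_le`). For small radii `K` is large and the gain
wins, so `A` fills at most half of the ball (`exists_truncated_ball_inter_le`). A larger ball still
contains the missing half of a fixed small one, so the centred maximal function stays below `1` on
`A`, up to a null set.

For (2), `M f` is at least the average of `f` at every point of a ball. A fixed point is thus almost
everywhere at least its own average there, hence equal to it; increasing balls then give a global
constant. -/

open scoped NNReal

/-! ### One-dimensional Gaussians under quadratic tilts -/

/-- Two Gaussian measures whose densities have ratio `g` differ by the density `g`. -/
theorem gaussianReal_eq_withDensity {m m' : ℝ} {v v' : ℝ≥0} (hv : v ≠ 0) (hv' : v' ≠ 0)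
    {g : ℝ → ℝ} (hg : Measurable g)
    (h : ∀ y, gaussianPDFReal m' v' y = gaussianPDFReal m v y * g y) :
    gaussianReal m' v' = (gaussianReal m v).withDensity fun y => ENNReal.ofReal (g y) := by
  rw [gaussianReal_of_var_ne_zero _ hv, gaussianReal_of_var_ne_zero _ hv',
    ← withDensity_mul _ (measurable_gaussianPDF m v) hg.ennreal_ofReal]
  congr 1
  ext y
  simp only [Pi.mul_apply, gaussianPDF_def]
  rw [h, ENNReal.ofReal_mul (gaussianPDFReal_nonneg _ _ _)]

/-- Tilting the standard Gaussian by `exp (-α (y - x)² / 2)` gives the Gaussian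
`N(α x / (1 + α), 1 / (1 + α))`. -/
theorem exists_gaussianReal_tilt (α : ℝ≥0) (x : ℝ) :
    ∃ c : ℝ, 0 < c ∧ gaussianReal (α * x / (1 + α)) (1 + α)⁻¹ =
      (gaussianReal 0 1).withDensity fun y =>
        ENNReal.ofReal (c * Real.exp (-(α * (y - x) ^ 2 / 2))) := by
  have h1 : (0 : ℝ) < 1 + α := by positivity
  refine ⟨√(1 + α) * Real.exp (α * x ^ 2 / (2 * (1 + α))), by positivity, ?_⟩
  refine gaussianReal_eq_withDensity one_ne_zero (by positivity) (by fun_prop) fun y => ?_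
  simp only [gaussianPDFReal, NNReal.coe_inv, NNReal.coe_add, NNReal.coe_one, mul_one, sub_zero]
  have h2 : (√(2 * Real.pi * (1 + (α : ℝ))⁻¹))⁻¹ = (√(2 * Real.pi))⁻¹ * √(1 + α) := by
    rw [Real.sqrt_mul (by positivity), Real.sqrt_inv, mul_inv, inv_inv]
  rw [h2]
  have h3 : Real.exp (-(y - α * x / (1 + α)) ^ 2 / (2 * (1 + (α : ℝ))⁻¹)) =
      Real.exp (-y ^ 2 / 2) * (Real.exp (α * x ^ 2 / (2 * (1 + α))) *
        Real.exp (-(α * (y - x) ^ 2 / 2))) := by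
    rw [← Real.exp_add, ← Real.exp_add]
    congr 1
    field_simp
    ring
  rw [h3]
  ring

/-- The exponential moment of the square of a Gaussian variable. -/
theorem lintegral_exp_mul_sq_gaussianReal (m a : ℝ) {v : ℝ≥0} (hv : v ≠ 0)
    (hp : 0 < 1 - 2 * a * v) :
    ∫⁻ y, ENNReal.ofReal (Real.exp (a * y ^ 2)) ∂gaussianReal m v =
      ENNReal.ofReal (Real.exp (a * m ^ 2 / (1 - 2 * a * v)) / √(1 - 2 * a * v)) := by
  set p : ℝ := 1 - 2 * a * v with hpdef
  have hv0 : (0 : ℝ) < v := by positivity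
  -- Completing the square, `exp (a y²)` times the density of `N(m, v)` is a multiple of the density
  -- of `N(m / p, v / p)`; total mass one then gives the integral.
  have key : gaussianReal (m / p) (v / p.toNNReal) = (gaussianReal m v).withDensity fun y =>
      ENNReal.ofReal ((√p * Real.exp (-(a * m ^ 2 / p))) * Real.exp (a * y ^ 2)) := by
    refine gaussianReal_eq_withDensity hv ?_ (by fun_prop) fun y => ?_
    · exact div_ne_zero hv (by simpa using hp)
    simp only [gaussianPDFReal, NNReal.coe_div, Real.coe_toNNReal _ hp.le]
    have h2 : (√(2 * Real.pi * (v / p)))⁻¹ = (√(2 * Real.pi * v))⁻¹ * √p := by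
      rw [← mul_div_assoc, Real.sqrt_div (by positivity), inv_div, div_eq_inv_mul]
    have h3 : Real.exp (-(y - m / p) ^ 2 / (2 * (v / p))) =
        Real.exp (-(y - m) ^ 2 / (2 * v)) * (Real.exp (-(a * m ^ 2 / p)) *
          Real.exp (a * y ^ 2)) := by
      rw [← Real.exp_add, ← Real.exp_add]
      congr 1
      field_simp
      rw [hpdef]
      ring
    rw [h2, h3]
    ring
  have h1 := congrArg (fun μ : Measure ℝ => μ Set.univ) key
  simp only [measure_univ, withDensity_apply _ MeasurableSet.univ, Measure.restrict_univ] at h1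
  have hc : 0 < √p * Real.exp (-(a * m ^ 2 / p)) := by positivity
  simp_rw [ENNReal.ofReal_mul hc.le] at h1
  rw [lintegral_const_mul _ (by fun_prop)] at h1
  have h4 : Real.exp (a * m ^ 2 / p) / √p = (√p * Real.exp (-(a * m ^ 2 / p)))⁻¹ := by
    rw [Real.exp_neg, mul_inv, inv_inv, div_eq_inv_mul]
  rw [h4, ENNReal.ofReal_inv_of_pos hc]
  exact ENNReal.eq_inv_of_mul_eq_one_left (by rw [mul_comm]; exact h1.symm)

/-! ### Densities on infinite product measures -/

/-- The integral of a finite product of functions of distinct coordinates. -/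
theorem lintegral_prod_infinitePi {ι : Type*} (ρ : ι → Measure ℝ)
    [∀ i, IsProbabilityMeasure (ρ i)] (S : Finset ι) {F : ι → ℝ → ℝ≥0∞}
    (hF : ∀ i, Measurable (F i)) :
    ∫⁻ y, ∏ i ∈ S, F i (y i) ∂Measure.infinitePi ρ = ∏ i ∈ S, ∫⁻ t, F i t ∂ρ i := by
  refine (lintegral_prod_eq_prod_lintegral_of_indepFun S (fun i (y : ι → ℝ) => F i (y i))
    (iIndepFun_infinitePi hF) fun i => (hF i).comp (measurable_pi_apply i)).trans ?_
  refine Finset.prod_congr rfl fun i _ => ?_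
  exact (measurePreserving_eval_infinitePi ρ i).lintegral_comp (hF i)

/-- Changing finitely many factors of an infinite product by densities. -/
theorem infinitePi_withDensity {ι : Type*} (ρ ρ' : ι → Measure ℝ)
    [∀ i, IsProbabilityMeasure (ρ i)] [∀ i, IsProbabilityMeasure (ρ' i)] (S : Finset ι)
    {F : ι → ℝ → ℝ≥0∞} (hF : ∀ i, Measurable (F i))
    (hS : ∀ i ∈ S, ρ' i = (ρ i).withDensity (F i)) (hS' : ∀ i ∉ S, ρ' i = ρ i) :
    Measure.infinitePi ρ' =
      (Measure.infinitePi ρ).withDensity fun y => ∏ i ∈ S, F i (y i) := by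
  classical
  symm
  refine Measure.eq_infinitePi _ fun s t ht => ?_
  -- The indicator of a box over `s` times the density over `S` is a product over `s ∪ S` of
  -- functions of single coordinates.
  let G : ι → ℝ → ℝ≥0∞ := fun i =>
    (if i ∈ s then t i else Set.univ).indicator (if i ∈ S then F i else 1)
  have hms : ∀ i, MeasurableSet (if i ∈ s then t i else Set.univ) := fun i => by
    split_ifs
    exacts [ht i, .univ]
  have hG : ∀ i, Measurable (G i) := fun i => by
    refine Measurable.indicator ?_ (hms i)
    split_ifs
    exacts [hF i, measurable_const]
  have hbox : MeasurableSet (Set.pi (s : Set ι) t) :=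
    MeasurableSet.pi s.countable_toSet fun i _ => ht i
  rw [withDensity_apply _ hbox, ← lintegral_indicator hbox]
  have h1 : ∀ y : ι → ℝ, (Set.pi (s : Set ι) t).indicator (fun y => ∏ i ∈ S, F i (y i)) y =
      ∏ i ∈ s ∪ S, G i (y i) := by
    intro y
    by_cases hy : y ∈ Set.pi (s : Set ι) t
    · rw [Set.indicator_of_mem hy]
      have : ∀ i ∈ s ∪ S, G i (y i) = if i ∈ S then F i (y i) else 1 := by
        intro i hi
        have hmem : y i ∈ (if i ∈ s then t i else Set.univ) := by
          split_ifs with his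
          exacts [hy i his, trivial]
        simp only [G, Set.indicator_of_mem hmem]
        split_ifs <;> rfl
      rw [Finset.prod_congr rfl this, Finset.prod_ite_mem]
      congr 1
      ext i
      simp
    · rw [Set.indicator_of_notMem hy]
      simp only [Set.mem_pi, not_forall] at hy
      obtain ⟨i, his, hi⟩ := hy
      refine (Finset.prod_eq_zero (i := i) (Finset.mem_union_left _ his) ?_).symm
      have : i ∈ s := his
      simp [G, this, hi]
  simp_rw [h1]
  rw [lintegral_prod_infinitePi ρ _ hG]
  have h2 : ∀ i, ∫⁻ u, G i u ∂ρ i = ρ' i (if i ∈ s then t i else Set.univ) := by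
    intro i
    simp only [G]
    rw [lintegral_indicator (hms i)]
    by_cases hi : i ∈ S
    · simp only [hi, if_true]
      rw [hS i hi, withDensity_apply _ (hms i)]
    · simp only [hi, if_false]
      rw [hS' i hi]
      simp
  rw [Finset.prod_congr rfl fun i _ => h2 i]
  have h3 : ∀ i, ρ' i (if i ∈ s then t i else Set.univ) = if i ∈ s then ρ' i (t i) else 1 := by
    intro i
    split_ifs <;> simp
  rw [Finset.prod_congr rfl fun i _ => h3 i, Finset.prod_ite_mem]
  congr 1
  ext i
  simp

/-! ### Moments of shifted squares -/

theorem integrable_sub_pow_gaussianReal (m : ℝ) (v : ℝ≥0) (x : ℝ) (n : ℕ) :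
    Integrable (fun y => (y - x) ^ n) (gaussianReal m v) := by
  have h : MemLp (fun y : ℝ => y - x) n (gaussianReal m v) := by
    have h0 := (memLp_id_gaussianReal (μ := m) (v := v) (n : ℝ≥0)).sub (memLp_const x)
    rw [ENNReal.coe_natCast] at h0
    exact h0
  exact (integrable_norm_iff (by fun_prop)).1 (by simpa using h.integrable_norm_pow')

theorem memLp_sub_sq_gaussianReal (m : ℝ) (v : ℝ≥0) (x : ℝ) :
    MemLp (fun y => (y - x) ^ 2) 2 (gaussianReal m v) := by
  rw [memLp_two_iff_integrable_sq (by fun_prop)]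
  simpa only [← pow_mul] using integrable_sub_pow_gaussianReal m v x 4

theorem integral_sub_sq_gaussianReal (m : ℝ) (v : ℝ≥0) (x : ℝ) :
    ∫ y, (y - x) ^ 2 ∂gaussianReal m v = v + (m - x) ^ 2 := by
  have h := variance_eq_sub (μ := gaussianReal m v) (X := fun y => y - x)
    ((memLp_id_gaussianReal 2).sub (memLp_const x))
  have h2 : Var[fun y => y - x; gaussianReal m v] = v := by
    rw [variance_sub_const (by fun_prop)]
    exact variance_fun_id_gaussianReal
  have h3 : ∫ y, (y - x) ∂gaussianReal m v = m - x := by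
    have h4 : Integrable (fun y : ℝ => y) (gaussianReal m v) := by
      simpa using integrable_sub_pow_gaussianReal m v 0 1
    rw [integral_sub h4 (integrable_const _)]
    simp
  rw [h2, h3] at h
  simp only [Pi.pow_apply] at h
  linarith

/-- Writing `y = √v h + m` with `h` standard, the square is a constant plus `2 (m - x) √v h + v h²`,
whose second moment is at most twice the sum of those of its two terms. A constant uniform in `m`,
`v` and `x` is what Chebyshev needs later. -/
theorem exists_variance_sub_sq_gaussianReal_le :
    ∃ C : ℝ, 0 < C ∧ ∀ (m : ℝ) (v : ℝ≥0) (x : ℝ),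
      Var[fun y => (y - x) ^ 2; gaussianReal m v] ≤ C * (v ^ 2 + v * (m - x) ^ 2) := by
  have hi : ∀ n : ℕ, Integrable (fun y : ℝ => y ^ n) (gaussianReal 0 1) := fun n => by
    simpa using integrable_sub_pow_gaussianReal 0 1 0 n
  set κ : ℝ := ∫ y, y ^ 4 ∂gaussianReal 0 1 with hκ
  have hκ0 : 0 ≤ κ := integral_nonneg fun y => by positivity
  refine ⟨8 + 2 * κ, by positivity, fun m v x => ?_⟩
  have hmap : gaussianReal m v = (gaussianReal 0 1).map fun h => √v * h + m := by
    have h1 := gaussianReal_map_const_mul (μ := 0) (v := 1) (√v)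
    have h2 := Measure.map_map (μ := gaussianReal 0 1) (f := fun h => √v * h)
      (g := fun h => h + m) (by fun_prop) (by fun_prop)
    rw [h1, gaussianReal_map_add_const, Function.comp_def] at h2
    rw [← h2]
    congr 1
    · simp
    · ext; simp
  rw [hmap, variance_map (by fun_prop) (by fun_prop)]
  have h1 : Var[(fun y => (y - x) ^ 2) ∘ (fun h => √v * h + m); gaussianReal 0 1] =
      Var[fun h => 2 * (m - x) * √v * h + v * h ^ 2; gaussianReal 0 1] := by
    rw [← variance_add_const (X := fun h => 2 * (m - x) * √v * h + v * h ^ 2) (by fun_prop)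
      ((m - x) ^ 2)]
    congr 1
    ext h
    simp only [Function.comp_apply]
    have := Real.sq_sqrt v.2
    calc (√v * h + m - x) ^ 2 = √v ^ 2 * h ^ 2 + 2 * (m - x) * √v * h + (m - x) ^ 2 := by ring
      _ = _ := by rw [show √(v : ℝ) ^ 2 = v from this]; ring
  rw [h1]
  refine (variance_le_expectation_sq (by fun_prop)).trans ?_
  have h2 : ∀ h : ℝ, ((fun h => 2 * (m - x) * √v * h + v * h ^ 2) ^ 2) h ≤
      8 * (m - x) ^ 2 * v * h ^ 2 + 2 * v ^ 2 * h ^ 4 := by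
    intro h
    have := Real.sq_sqrt v.2
    have h3 : (2 * (m - x) * √v * h) ^ 2 = 4 * (m - x) ^ 2 * v * h ^ 2 := by
      rw [mul_pow, mul_pow, mul_pow, show √(v : ℝ) ^ 2 = v from this]; ring
    simp only [Pi.pow_apply]
    nlinarith [sq_nonneg (2 * (m - x) * √v * h - v * h ^ 2)]
  have hE2 : ∫ y, y ^ 2 ∂gaussianReal 0 1 = 1 := by
    simpa using integral_sub_sq_gaussianReal 0 1 0
  calc _ ≤ ∫ h, (8 * (m - x) ^ 2 * v * h ^ 2 + 2 * v ^ 2 * h ^ 4) ∂gaussianReal 0 1 :=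
        integral_mono_of_nonneg (Filter.Eventually.of_forall fun h => by
          simp only [Pi.pow_apply, Pi.zero_apply]; positivity)
          (((hi 2).const_mul _).add ((hi 4).const_mul _)) (Filter.Eventually.of_forall h2)
    _ = 8 * (m - x) ^ 2 * v + 2 * v ^ 2 * κ := by
        rw [integral_add ((hi 2).const_mul _) ((hi 4).const_mul _), integral_const_mul,
          integral_const_mul, hE2, mul_one]
    _ ≤ _ := by
        have : 0 ≤ (v : ℝ) := v.2
        nlinarith [mul_nonneg hκ0 (mul_nonneg this (sq_nonneg (m - x))), sq_nonneg (v : ℝ)]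

/-! ### Tilted measures and their comparison with balls -/

/-- The law of independent Gaussian variables with laws `N(αᵢ xᵢ / (1 + αᵢ), 1 / (1 + αᵢ))`. -/
noncomputable def tiltedSeq (α : ℕ → ℝ≥0) (x : ℕ → ℝ) : Measure (ℕ → ℝ) :=
  Measure.infinitePi fun i => gaussianReal (α i * x i / (1 + α i)) (1 + α i)⁻¹

instance (α : ℕ → ℝ≥0) (x : ℕ → ℝ) : IsProbabilityMeasure (tiltedSeq α x) := by
  unfold tiltedSeq; infer_instance

instance : IsProbabilityMeasure stdGaussianSeq := by
  unfold stdGaussianSeq; infer_instance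

theorem exists_tiltedSeq_eq_withDensity (α : ℕ → ℝ≥0) (x : ℕ → ℝ) (S : Finset ℕ)
    (hα : ∀ i ∉ S, α i = 0) :
    ∃ c : ℝ, 0 < c ∧ tiltedSeq α x = stdGaussianSeq.withDensity fun y =>
      ENNReal.ofReal (c * Real.exp (-(∑ i ∈ S, α i * (y i - x i) ^ 2) / 2)) := by
  choose c hc h using fun i => exists_gaussianReal_tilt (α i) (x i)
  refine ⟨∏ i ∈ S, c i, Finset.prod_pos fun i _ => hc i, ?_⟩
  have := infinitePi_withDensity (fun _ : ℕ => gaussianReal 0 1)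
    (fun i => gaussianReal (α i * x i / (1 + α i)) (1 + α i)⁻¹) S
    (F := fun i t => ENNReal.ofReal (c i * Real.exp (-(α i * (t - x i) ^ 2 / 2))))
    (fun i => by fun_prop) (fun i _ => h i) (fun i hi => by simp [hα i hi])
  rw [tiltedSeq, this, stdGaussianSeq]
  congr 1
  ext y
  rw [← ENNReal.ofReal_prod_of_nonneg fun i _ => by have := hc i; positivity,
    Finset.prod_mul_distrib, ← Real.exp_sum, Finset.sum_neg_distrib, neg_div, Finset.sum_div]

theorem integral_sum_infinitePi (ρ : ℕ → Measure ℝ) [∀ i, IsProbabilityMeasure (ρ i)]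
    (S : Finset ℕ) {F : ℕ → ℝ → ℝ} (hF : ∀ i, Integrable (F i) (ρ i)) :
    ∫ y, ∑ i ∈ S, F i (y i) ∂Measure.infinitePi ρ = ∑ i ∈ S, ∫ t, F i t ∂ρ i := by
  have hmp := fun i => measurePreserving_eval_infinitePi ρ i
  refine (integral_finsetSum _ fun i _ => (hmp i).integrable_comp_of_integrable (hF i)).trans ?_
  refine Finset.sum_congr rfl fun i _ => ?_
  rw [← (hmp i).map_eq, integral_map (hmp i).aemeasurable]
  · simp
  · rw [(hmp i).map_eq]; exact (hF i).1

theorem memLp_sum_infinitePi (ρ : ℕ → Measure ℝ) [∀ i, IsProbabilityMeasure (ρ i)]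
    (S : Finset ℕ) {F : ℕ → ℝ → ℝ} (hF : ∀ i, MemLp (F i) 2 (ρ i)) :
    MemLp (fun y => ∑ i ∈ S, F i (y i)) 2 (Measure.infinitePi ρ) :=
  memLp_finsetSum _ fun i _ =>
    (hF i).comp_measurePreserving (measurePreserving_eval_infinitePi ρ i)

theorem variance_sum_infinitePi (ρ : ℕ → Measure ℝ) [∀ i, IsProbabilityMeasure (ρ i)]
    (S : Finset ℕ) {F : ℕ → ℝ → ℝ} (hm : ∀ i, Measurable (F i))
    (hF : ∀ i, MemLp (F i) 2 (ρ i)) :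
    Var[fun y => ∑ i ∈ S, F i (y i); Measure.infinitePi ρ] = ∑ i ∈ S, Var[F i; ρ i] := by
  have hmp := fun i => measurePreserving_eval_infinitePi ρ i
  have h := IndepFun.variance_sum (μ := Measure.infinitePi ρ) (X := fun i y => F i (y i)) (s := S)
    (fun i _ => (hF i).comp_measurePreserving (hmp i))
    (fun i _ j _ hij => (iIndepFun_infinitePi hm).indepFun hij)
  have h2 : (∑ i ∈ S, fun y : ℕ → ℝ => F i (y i)) = fun y => ∑ i ∈ S, F i (y i) := by
    ext y; simp
  rw [h2] at h
  rw [h]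
  refine Finset.sum_congr rfl fun i _ => ?_
  change Var[F i ∘ (fun y => y i); Measure.infinitePi ρ] = _
  rw [← variance_map, (hmp i).map_eq]
  · rw [(hmp i).map_eq]; exact (hm i).aemeasurable
  · exact (hmp i).aemeasurable

/-- Chebyshev's inequality for a sum of independent coordinates. -/
theorem infinitePi_le_abs_sum_sub (ρ : ℕ → Measure ℝ) [∀ i, IsProbabilityMeasure (ρ i)]
    (S : Finset ℕ) {F : ℕ → ℝ → ℝ} (hm : ∀ i, Measurable (F i))
    (hF : ∀ i, MemLp (F i) 2 (ρ i)) {c : ℝ} (hc : 0 < c) :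
    Measure.infinitePi ρ {y | c ≤ |∑ i ∈ S, F i (y i) - ∑ i ∈ S, ∫ t, F i t ∂ρ i|} ≤
      ENNReal.ofReal ((∑ i ∈ S, Var[F i; ρ i]) / c ^ 2) := by
  have := meas_ge_le_variance_div_sq (memLp_sum_infinitePi ρ S hF) hc
  rwa [variance_sum_infinitePi ρ S hm hF,
    integral_sum_infinitePi ρ S fun i => (hF i).integrable (by norm_num)] at this

/-- Under the tilted measure, the quadratic form is within `2 D` of its mean with probability at
least `3 / 4`. -/
theorem exists_tiltedSeq_concentration :
    ∃ C : ℝ, 0 < C ∧ ∀ (α : ℕ → ℝ≥0) (x : ℕ → ℝ) (S : Finset ℕ) (D : ℝ), 0 < D →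
      C * ∑ i ∈ S, ((α i : ℝ) / (1 + α i)) ^ 2 * (1 + x i ^ 2) ≤ D ^ 2 →
      3 / 4 ≤ tiltedSeq α x {y | |∑ i ∈ S, (α i : ℝ) * (y i - x i) ^ 2 -
        ∑ i ∈ S, (α i : ℝ) / (1 + α i) * (1 + x i ^ 2 / (1 + α i))| < 2 * D} := by
  obtain ⟨C, hC, hvar⟩ := exists_variance_sub_sq_gaussianReal_le
  refine ⟨C, hC, fun α x S D hD hCD => ?_⟩
  set ρ : ℕ → Measure ℝ := fun i => gaussianReal (α i * x i / (1 + α i)) (1 + α i)⁻¹ with hρ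
  set F : ℕ → ℝ → ℝ := fun i t => α i * (t - x i) ^ 2 with hF
  have h := infinitePi_le_abs_sum_sub ρ S (F := F) (fun i => by fun_prop)
    (fun i => (memLp_sub_sq_gaussianReal _ _ _).const_mul _) (c := 2 * D) (by positivity)
  have hmean : ∀ i, ∫ t, F i t ∂ρ i = (α i : ℝ) / (1 + α i) * (1 + x i ^ 2 / (1 + α i)) := by
    intro i
    rw [integral_const_mul, integral_sub_sq_gaussianReal]
    have : (0 : ℝ) < 1 + α i := by positivity
    push_cast
    field_simp
    ring
  -- With `σ = 1 / (1 + αᵢ)`, the variance is `σ` and the mean is off `xᵢ` by `-σ xᵢ`; the surplus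
  -- factor `σ ≤ 1` is dropped.
  have hv : ∀ i, Var[F i; ρ i] ≤ C * (((α i : ℝ) / (1 + α i)) ^ 2 * (1 + x i ^ 2)) := by
    intro i
    have h0 : (0 : ℝ) < 1 + α i := by positivity
    have h1 : (1 + (α i : ℝ))⁻¹ ≤ 1 := inv_le_one_of_one_le₀ (by simp)
    rw [variance_const_mul]
    refine (mul_le_mul_of_nonneg_left (hvar _ _ _) (sq_nonneg _)).trans ?_
    have h2 : (α i : ℝ) * x i / (1 + α i) - x i = -(x i * (1 + (α i : ℝ))⁻¹) := by
      field_simp; ring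
    rw [h2]
    push_cast
    set σ := (1 + (α i : ℝ))⁻¹
    have hσ : 0 ≤ σ := by positivity
    rw [div_eq_mul_inv]
    have : σ * (x i * σ) ^ 2 ≤ σ ^ 2 * x i ^ 2 := by
      have := mul_le_mul_of_nonneg_left h1 (by positivity : 0 ≤ σ ^ 2 * x i ^ 2)
      linarith [this, show σ * (x i * σ) ^ 2 = σ ^ 2 * x i ^ 2 * σ by ring]
    calc (α i : ℝ) ^ 2 * (C * (σ ^ 2 + σ * (-(x i * σ)) ^ 2))
        = (α i : ℝ) ^ 2 * C * (σ ^ 2 + σ * (x i * σ) ^ 2) := by ring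
      _ ≤ (α i : ℝ) ^ 2 * C * (σ ^ 2 + σ ^ 2 * x i ^ 2) := by gcongr
      _ = _ := by ring
  have hsum : (∑ i ∈ S, Var[F i; ρ i]) / (2 * D) ^ 2 ≤ 1 / 4 := by
    rw [div_le_iff₀ (by positivity)]
    calc ∑ i ∈ S, Var[F i; ρ i] ≤ ∑ i ∈ S, C * (((α i : ℝ) / (1 + α i)) ^ 2 * (1 + x i ^ 2)) :=
          Finset.sum_le_sum fun i _ => hv i
      _ ≤ D ^ 2 := by rw [← Finset.mul_sum]; exact hCD
      _ = _ := by ring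
  have h4 : tiltedSeq α x {y | |∑ i ∈ S, (α i : ℝ) * (y i - x i) ^ 2 -
      ∑ i ∈ S, (α i : ℝ) / (1 + α i) * (1 + x i ^ 2 / (1 + α i))| < 2 * D}ᶜ ≤ 1 / 4 := by
    simp only [Set.compl_ofPred, not_lt]
    simp_rw [hmean] at h
    refine h.trans ((ENNReal.ofReal_le_ofReal hsum).trans ?_)
    rw [ENNReal.ofReal_div_of_pos (by norm_num)]
    simp
  rw [prob_compl_eq_one_sub (measurableSet_lt (by fun_prop) (by fun_prop))] at h4
  have h5 := tsub_le_iff_right.1 h4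
  have h6 : (3 : ℝ≥0∞) / 4 + 1 / 4 = 1 := by
    rw [ENNReal.div_add_div_same]; norm_num
    exact ENNReal.div_self (by norm_num) (by norm_num)
  replace h5 := h6.le.trans (h5.trans_eq (add_comm _ _))
  exact (ENNReal.add_le_add_iff_right (by norm_num)).1 h5

/-- Comparison of a weighted ball with its intersection with an event `A`: the proportion of `A`
is at most its tilted probability, up to the factor `exp (2 D)`. -/
theorem exists_stdGaussianSeq_inter_le :
    ∃ C : ℝ, 0 < C ∧ ∀ (α : ℕ → ℝ≥0) (x : ℕ → ℝ) (S : Finset ℕ) (D R : ℝ) (A : Set (ℕ → ℝ)),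
      (∀ i ∉ S, α i = 0) → 0 < D → MeasurableSet A →
      C * ∑ i ∈ S, ((α i : ℝ) / (1 + α i)) ^ 2 * (1 + x i ^ 2) ≤ D ^ 2 →
      ∑ i ∈ S, (α i : ℝ) / (1 + α i) * (1 + x i ^ 2 / (1 + α i)) + 2 * D = R →
      stdGaussianSeq ({y | ∑ i ∈ S, (α i : ℝ) * (y i - x i) ^ 2 ≤ R} ∩ A) * (3 / 4) ≤
        tiltedSeq α x A * ENNReal.ofReal (Real.exp (2 * D)) *
          stdGaussianSeq {y | ∑ i ∈ S, (α i : ℝ) * (y i - x i) ^ 2 ≤ R} := by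
  obtain ⟨C, hC, hconc⟩ := exists_tiltedSeq_concentration
  refine ⟨C, hC, fun α x S D R A hα hD hA hCD hR => ?_⟩
  obtain ⟨c, hc, hν⟩ := exists_tiltedSeq_eq_withDensity α x S hα
  set X : (ℕ → ℝ) → ℝ := fun y => ∑ i ∈ S, (α i : ℝ) * (y i - x i) ^ 2 with hX
  have hXm : Measurable X := by fun_prop
  have h34 := hconc α x S D hD hCD
  set B : Set (ℕ → ℝ) := {y | X y ≤ R} with hB
  have hBm : MeasurableSet B := measurableSet_le hXm measurable_const
  set T : Set (ℕ → ℝ) := {y | |X y -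
    ∑ i ∈ S, (α i : ℝ) / (1 + α i) * (1 + x i ^ 2 / (1 + α i))| < 2 * D} with hT
  have hTm : MeasurableSet T := measurableSet_lt (by fun_prop) (by fun_prop)
  -- The tilted density is `c exp (-X / 2)`: at least `c exp (-R / 2)` on the ball `X ≤ R`.
  have h1 : ENNReal.ofReal (c * Real.exp (-R / 2)) * stdGaussianSeq (B ∩ A) ≤ tiltedSeq α x A := by
    refine le_trans ?_ (measure_mono (Set.inter_subset_right (s := B)))
    rw [hν, withDensity_apply _ (hBm.inter hA), ← setLIntegral_const]
    refine setLIntegral_mono (by fun_prop) fun y hy => ?_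
    have : X y ≤ R := hy.1
    gcongr
  -- As `R` is the mean plus `2 D`, the concentration event lies inside the ball, and there `X > R -
  -- 4 D`. The density thus exceeds its lower bound on the ball by at most the factor `exp (2 D)`.
  have h2 : (3 / 4 : ℝ≥0∞) ≤
      ENNReal.ofReal (c * Real.exp (-(R - 4 * D) / 2)) * stdGaussianSeq B := by
    refine h34.trans ?_
    have hTB : T ⊆ B := fun y hy => by
      simp only [hT, hB, Set.mem_ofPred_eq, abs_lt] at hy ⊢
      linarith [hy.2]
    refine le_trans ?_ (mul_le_mul_right (measure_mono hTB) _)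
    rw [hν, withDensity_apply _ hTm, ← setLIntegral_const]
    refine setLIntegral_mono (by fun_prop) fun y hy => ?_
    simp only [hT, Set.mem_ofPred_eq, abs_lt] at hy
    have := hy.1
    change ENNReal.ofReal (c * Real.exp (-(X y) / 2)) ≤ _
    gcongr
    linarith
  have h3 : c * Real.exp (-(R - 4 * D) / 2) = c * Real.exp (-R / 2) * Real.exp (2 * D) := by
    rw [mul_assoc, ← Real.exp_add]; congr 2; ring
  have hk : 0 < c * Real.exp (-R / 2) := by positivity
  rw [h3, ENNReal.ofReal_mul hk.le] at h2
  set k := ENNReal.ofReal (c * Real.exp (-R / 2)) with hkdef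
  have hk0 : k ≠ 0 := by simpa [hkdef] using hk
  have hkt : k ≠ ∞ := ENNReal.ofReal_ne_top
  rw [← ENNReal.mul_le_mul_iff_right hk0 hkt]
  calc k * (stdGaussianSeq (B ∩ A) * (3 / 4)) = k * stdGaussianSeq (B ∩ A) * (3 / 4) := by ring
    _ ≤ tiltedSeq α x A * (k * ENNReal.ofReal (Real.exp (2 * D)) * stdGaussianSeq B) := by
        gcongr
    _ = _ := by ring

/-- Chernoff bound: under the tilted measure with tilt `β ∈ [1, 4]` on `J`, the sum of squares
over `J` is smaller than typical, except on an event of exponentially small probability. -/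
theorem tiltedSeq_sum_sq_ge_le (α : ℕ → ℝ≥0) (x : ℕ → ℝ) (J : Finset ℕ) {β : ℝ≥0}
    (hβ : 1 ≤ β) (hβ' : β ≤ 4) (hα : ∀ i ∈ J, α i = β)
    (hx : ∑ i ∈ J, x i ^ 2 ≤ 51 / 50 * J.card) :
    tiltedSeq α x {y | 49 / 50 * (J.card : ℝ) ≤ ∑ i ∈ J, y i ^ 2} ≤
      ENNReal.ofReal (Real.exp (-(J.card : ℝ) / 1000)) := by
  set n : ℝ := (J.card : ℝ) with hn
  have hn0 : 0 ≤ n := by positivity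
  set σ : ℝ := (1 + (β : ℝ))⁻¹ with hσ
  have hβr : (1 : ℝ) ≤ β := by exact_mod_cast hβ
  have hβr' : (β : ℝ) ≤ 4 := by exact_mod_cast hβ'
  have hσ1 : 1 / 5 ≤ σ := by
    rw [hσ, one_div]; exact inv_anti₀ (by positivity) (by linarith)
  have hσ2 : σ ≤ 1 / 2 := by
    rw [hσ, one_div]; exact inv_anti₀ (by positivity) (by linarith)
  have hs : (β : ℝ) / (1 + β) = 1 - σ := by
    rw [hσ]; field_simp; ring
  set p : ℝ := 1 - 2 * (1 / 100) * σ with hp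
  have hp0 : 0 < p := by rw [hp]; linarith
  have hint : ∫⁻ y, ENNReal.ofReal (Real.exp (1 / 100 * ∑ i ∈ J, y i ^ 2)) ∂tiltedSeq α x =
      ENNReal.ofReal (Real.exp (1 / 100 * (1 - σ) ^ 2 * (∑ i ∈ J, x i ^ 2) / p) *
        (√p)⁻¹ ^ J.card) := by
    have h1 : ∀ y : ℕ → ℝ, ENNReal.ofReal (Real.exp (1 / 100 * ∑ i ∈ J, y i ^ 2)) =
        ∏ i ∈ J, ENNReal.ofReal (Real.exp (1 / 100 * y i ^ 2)) := fun y => by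
      rw [← ENNReal.ofReal_prod_of_nonneg fun i _ => (Real.exp_pos _).le, ← Real.exp_sum,
        Finset.mul_sum]
    simp_rw [h1]
    rw [tiltedSeq, lintegral_prod_infinitePi _ J
      (F := fun _ t => ENNReal.ofReal (Real.exp (1 / 100 * t ^ 2))) fun i => by fun_prop]
    have h2 : ∀ i ∈ J, ∫⁻ t, ENNReal.ofReal (Real.exp (1 / 100 * t ^ 2))
        ∂gaussianReal (α i * x i / (1 + α i)) (1 + α i)⁻¹ =
        ENNReal.ofReal (Real.exp (1 / 100 * (1 - σ) ^ 2 * x i ^ 2 / p) * (√p)⁻¹) := by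
      intro i hi
      have hv : (((1 + α i)⁻¹ : ℝ≥0) : ℝ) = σ := by rw [hα i hi]; push_cast; rfl
      rw [lintegral_exp_mul_sq_gaussianReal _ _ (by positivity) (by rw [hv]; exact hp0), hv,
        div_eq_mul_inv (Real.exp _)]
      congr 3
      have : (α i : ℝ) * x i / (1 + α i) = (1 - σ) * x i := by rw [hα i hi, ← hs]; ring
      rw [this]
      ring
    rw [Finset.prod_congr rfl h2, ← ENNReal.ofReal_prod_of_nonneg fun i _ => by positivity,
      Finset.prod_mul_distrib, ← Real.exp_sum, Finset.prod_const, Finset.mul_sum, Finset.sum_div]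
  -- This is `1 / p ≤ exp (1 / p - 1)` after a square root, since `1 / p - 1 = 2 σ / (100 p)`.
  have hsqrt : (√p)⁻¹ ≤ Real.exp (σ / (100 * p)) := by
    have h1 : p⁻¹ ≤ Real.exp (σ / (100 * p)) ^ 2 := by
      rw [← Real.exp_nat_mul]
      have h2 := Real.add_one_le_exp (p⁻¹ - 1)
      have h3 : ((2 : ℕ) : ℝ) * (σ / (100 * p)) = p⁻¹ - 1 := by
        push_cast; field_simp; rw [hp]; ring
      rw [h3]; linarith
    rw [← Real.sqrt_inv]
    exact Real.sqrt_le_iff.2 ⟨by positivity, h1⟩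
  have hexp : Real.exp (1 / 100 * (1 - σ) ^ 2 * (∑ i ∈ J, x i ^ 2) / p) * (√p)⁻¹ ^ J.card ≤
      Real.exp (1 / 100 * (49 / 50 * n)) * Real.exp (-n / 1000) := by
    calc _ ≤ Real.exp (1 / 100 * (1 - σ) ^ 2 * (51 / 50 * n) / p) *
          Real.exp (σ / (100 * p)) ^ J.card := by gcongr
      _ = Real.exp (n * ((51 / 50 * (1 - σ) ^ 2 + σ) / p) / 100) := by
          rw [← Real.exp_nat_mul, ← Real.exp_add, ← hn]; congr 1; field_simp
      -- The margin between `88 / 100` and the threshold `98 / 100`, times the Chernoff parameter `1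
      -- / 100`, is the rate `1 / 1000`.
      _ ≤ Real.exp (n * (88 / 100) / 100) := by
          have h1 : (51 / 50 * (1 - σ) ^ 2 + σ) / p ≤ 88 / 100 := by
            rw [div_le_iff₀ hp0, hp]
            nlinarith
          have h2 := mul_le_mul_of_nonneg_left h1 hn0
          exact Real.exp_le_exp.2 (by linarith)
      _ = _ := by rw [← Real.exp_add]; congr 1; ring
  have hM := mul_meas_ge_le_lintegral (μ := tiltedSeq α x)
    (f := fun y => ENNReal.ofReal (Real.exp (1 / 100 * ∑ i ∈ J, y i ^ 2))) (by fun_prop)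
    (ENNReal.ofReal (Real.exp (1 / 100 * (49 / 50 * n))))
  rw [hint] at hM
  have hset : {y : ℕ → ℝ | ENNReal.ofReal (Real.exp (1 / 100 * (49 / 50 * n))) ≤
      ENNReal.ofReal (Real.exp (1 / 100 * ∑ i ∈ J, y i ^ 2))} =
      {y | 49 / 50 * n ≤ ∑ i ∈ J, y i ^ 2} := by
    ext y
    simp only [Set.mem_ofPred_eq]
    rw [ENNReal.ofReal_le_ofReal_iff (Real.exp_pos _).le, Real.exp_le_exp]
    exact mul_le_mul_iff_right₀ (by norm_num)
  rw [hset] at hM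
  have hM2 := hM.trans (ENNReal.ofReal_le_ofReal hexp)
  rw [ENNReal.ofReal_mul (Real.exp_pos _).le] at hM2
  exact (ENNReal.mul_le_mul_iff_right (by simp [Real.exp_pos]) ENNReal.ofReal_ne_top).1 hM2

/-! ### Dyadic weights and the typical set -/

/-- The `k`-th dyadic block of indices, of size `2 ^ k`. -/
def dyadicBlock (k : ℕ) : Finset ℕ := Finset.Ico (2 ^ k - 1) (2 ^ (k + 1) - 1)

/-- The weights of Preiss's example: `4⁻ᵏ` on the `k`-th dyadic block. -/
noncomputable def preissWeight (i : ℕ) : ℝ≥0 := (4 ^ Nat.log 2 (i + 1))⁻¹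

theorem card_dyadicBlock (k : ℕ) : (dyadicBlock k).card = 2 ^ k := by
  have := Nat.one_le_two_pow (n := k)
  simp [dyadicBlock, pow_succ]
  omega

theorem preissWeight_of_mem {i k : ℕ} (hi : i ∈ dyadicBlock k) :
    preissWeight i = (4 ^ k)⁻¹ := by
  simp only [dyadicBlock, Finset.mem_Ico] at hi
  rw [preissWeight, Nat.log_eq_of_pow_le_of_lt_pow (m := k) (by omega) (by omega)]

theorem sum_range_dyadic (f : ℕ → ℝ) (L : ℕ) :
    ∑ i ∈ Finset.range (2 ^ L - 1), f i = ∑ j ∈ Finset.range L, ∑ i ∈ dyadicBlock j, f i := by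
  induction L with
  | zero => simp
  | succ L ih =>
    rw [Finset.sum_range_succ, ← ih, dyadicBlock, Finset.sum_range_add_sum_Ico]
    have := Nat.one_le_two_pow (n := L)
    rw [pow_succ]
    omega

theorem sum_two_pow_mul_min_le (K L : ℕ) :
    ∑ j ∈ Finset.range L, (2 : ℝ) ^ j * min 1 (4 ^ (K + 1) / 4 ^ j) ≤ 6 * 2 ^ K := by
  have key : ∀ d : ℕ, ∑ j ∈ Finset.range (K + 1 + d), (2 : ℝ) ^ j * min 1 (4 ^ (K + 1) / 4 ^ j) ≤
      2 ^ (K + 1) * (3 - 2 * (1 / 2) ^ d) := by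
    intro d
    induction d with
    | zero =>
      calc _ ≤ ∑ j ∈ Finset.range (K + 1), (2 : ℝ) ^ j := by
            refine Finset.sum_le_sum fun j _ => ?_
            exact mul_le_of_le_one_right (by positivity) (min_le_left _ _)
        _ = 2 ^ (K + 1) - 1 := by rw [geom_sum_eq (by norm_num)]; norm_num
        _ ≤ _ := by norm_num
    | succ d ih =>
      rw [← add_assoc, Finset.sum_range_succ]
      have h1 : (2 : ℝ) ^ (K + 1 + d) * min 1 (4 ^ (K + 1) / 4 ^ (K + 1 + d)) ≤
          2 ^ (K + 1) * (1 / 2) ^ d := by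
        refine (mul_le_mul_of_nonneg_left (min_le_right _ _) (by positivity)).trans_eq ?_
        rw [pow_add 4 (K + 1) d, pow_add 2 (K + 1), div_mul_eq_div_div, div_self (by positivity),
          show (4 : ℝ) = 2 * 2 by norm_num, mul_pow, one_div_pow]
        field_simp
      rw [pow_succ (1 / 2 : ℝ) d]
      linarith
  calc _ ≤ ∑ j ∈ Finset.range (K + 1 + L), (2 : ℝ) ^ j * min 1 (4 ^ (K + 1) / 4 ^ j) :=
        Finset.sum_le_sum_of_subset_of_nonneg
          (Finset.range_subset_range.2 (by omega)) fun j _ _ => by positivity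
    _ ≤ 2 ^ (K + 1) * (3 - 2 * (1 / 2) ^ L) := key L
    _ ≤ 2 ^ (K + 1) * 3 := by gcongr; simp
    _ = _ := by ring

/-- On block `j` the factor `θ w / (1 + θ w)` is at most `min 1 (θ / 4 ^ j)`. Beyond block `K` this
decays like `4⁻ʲ` while block sizes only double, so about `2 ^ K` coordinates are effective. The
same bound serves both the mean and the variance of the tilted form. -/
theorem sum_tilt_le {x : ℕ → ℝ} {B : ℝ}
    (hB : ∀ j, ∑ i ∈ dyadicBlock j, (1 + x i ^ 2) ≤ B * 2 ^ j) {θ : ℝ} (hθ : 0 ≤ θ) {K : ℕ}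
    (hK : θ ≤ 4 ^ (K + 1)) (L : ℕ) :
    ∑ i ∈ Finset.range (2 ^ L - 1),
      θ * preissWeight i / (1 + θ * preissWeight i) * (1 + x i ^ 2) ≤ 6 * B * 2 ^ K := by
  have hB0 : 0 ≤ B := by
    refine le_trans ?_ ((hB 0).trans_eq (by simp))
    exact Finset.sum_nonneg fun i _ => by positivity
  rw [sum_range_dyadic]
  calc _ ≤ ∑ j ∈ Finset.range L, B * ((2 : ℝ) ^ j * min 1 (4 ^ (K + 1) / 4 ^ j)) := by
        refine Finset.sum_le_sum fun j _ => ?_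
        calc _ ≤ ∑ i ∈ dyadicBlock j, min 1 (4 ^ (K + 1) / 4 ^ j) * (1 + x i ^ 2) := by
              refine Finset.sum_le_sum fun i hi => ?_
              gcongr
              rw [preissWeight_of_mem hi]
              push_cast
              have h0 : 0 ≤ θ * (4 ^ j)⁻¹ := by positivity
              refine le_min ?_ ?_
              · exact div_le_one_of_le₀ (by linarith) (by linarith)
              · refine (div_le_self h0 (by linarith)).trans ?_
                rw [div_eq_mul_inv]
                gcongr
          _ = min 1 (4 ^ (K + 1) / 4 ^ j) * ∑ i ∈ dyadicBlock j, (1 + x i ^ 2) := by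
              rw [Finset.mul_sum]
          _ ≤ min 1 (4 ^ (K + 1) / 4 ^ j) * (B * 2 ^ j) := by
              gcongr
              exact hB j
          _ = _ := by ring
    _ = B * ∑ j ∈ Finset.range L, (2 : ℝ) ^ j * min 1 (4 ^ (K + 1) / 4 ^ j) := by
        rw [Finset.mul_sum]
    _ ≤ B * (6 * 2 ^ K) := by
        gcongr
        exact sum_two_pow_mul_min_le K L
    _ = _ := by ring

/-- The comparison cost, of order `√(2 ^ K)`, loses to the Chernoff gain `2 ^ K / 1000`. The target
`3 / 8` is `1 / 2` times the `3 / 4` of the concentration bound. -/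
theorem exists_forall_exp_sub_le (c : ℝ) :
    ∃ K₁ : ℕ, ∀ K ≥ K₁, Real.exp (2 * √(c * 2 ^ K) - 2 ^ K / 1000) ≤ 3 / 8 := by
  have h : Filter.Tendsto (fun K : ℕ => (2 : ℝ) ^ K) Filter.atTop Filter.atTop :=
    tendsto_pow_atTop_atTop_of_one_lt (by norm_num)
  obtain ⟨K₁, hK₁⟩ := Filter.eventually_atTop.1
    (h.eventually_ge_atTop ((1000 * (2 * √|c| + 2)) ^ 2))
  refine ⟨K₁, fun K hK => ?_⟩
  have h1 := hK₁ K hK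
  set a := √|c|
  have ha : 0 ≤ a := Real.sqrt_nonneg _
  set u := √((2 : ℝ) ^ K) with hu
  have hu2 : u ^ 2 = 2 ^ K := Real.sq_sqrt (by positivity)
  have h2 : 1000 * (2 * a + 2) ≤ u := Real.le_sqrt_of_sq_le h1
  have h3 : √(c * 2 ^ K) ≤ a * u := by
    rw [← Real.sqrt_mul (abs_nonneg _)]
    gcongr
    exact le_abs_self c
  have h4 : 2 * √(c * 2 ^ K) - 2 ^ K / 1000 ≤ -2 := by
    have h5 := mul_le_mul_of_nonneg_right h2 (Real.sqrt_nonneg ((2 : ℝ) ^ K))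
    rw [← hu] at h5
    have h6 : 0 ≤ a * u := by positivity
    linarith [show u ^ 2 = u * u from pow_two u,
      show 1000 * (2 * a + 2) * u = 2000 * (a * u) + 2000 * u by ring]
  calc Real.exp (2 * √(c * 2 ^ K) - 2 ^ K / 1000) ≤ Real.exp (-2) := Real.exp_le_exp.2 h4
    _ ≤ 3 / 8 := by
      rw [Real.exp_neg, inv_le_comm₀ (Real.exp_pos _) (by norm_num)]
      linarith [Real.add_one_le_exp (2 : ℝ)]

/-- Sequences whose sums of squares over all dyadic blocks from the `K₀`-th on are close to
typical. -/
def typicalSet (K₀ : ℕ) : Set (ℕ → ℝ) :=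
  {y | ∀ K ≥ K₀, |∑ i ∈ dyadicBlock K, y i ^ 2 - 2 ^ K| ≤ 2 ^ K / 50}

theorem measurableSet_typicalSet (K₀ : ℕ) : MeasurableSet (typicalSet K₀) := by
  have : typicalSet K₀ = ⋂ (K : ℕ) (_ : K ≥ K₀),
      {y | |∑ i ∈ dyadicBlock K, y i ^ 2 - 2 ^ K| ≤ 2 ^ K / 50} := by
    ext; simp [typicalSet]
  rw [this]
  exact MeasurableSet.iInter fun K => MeasurableSet.iInter fun _ =>
    measurableSet_le (by fun_prop) measurable_const

theorem exists_blockBound_of_mem_typicalSet {K₀ : ℕ} {x : ℕ → ℝ} (hx : x ∈ typicalSet K₀) :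
    ∃ B : ℝ, ∀ j, ∑ i ∈ dyadicBlock j, (1 + x i ^ 2) ≤ B * 2 ^ j := by
  have h0 : ∀ j, 0 ≤ ∑ i ∈ dyadicBlock j, (1 + x i ^ 2) := fun j =>
    Finset.sum_nonneg fun i _ => by positivity
  -- The finitely many early blocks are bounded by their total; a later one contributes at most `(1
  -- + 51 / 50) 2 ^ j ≤ 3 * 2 ^ j`.
  refine ⟨∑ j ∈ Finset.range K₀, ∑ i ∈ dyadicBlock j, (1 + x i ^ 2) + 3, fun j => ?_⟩
  have hS := Finset.sum_nonneg fun j (_ : j ∈ Finset.range K₀) => h0 j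
  by_cases hj : j < K₀
  · have h1 := Finset.single_le_sum (fun j _ => h0 j) (Finset.mem_range.2 hj)
    have h2 : (1 : ℝ) ≤ 2 ^ j := one_le_pow₀ (by norm_num)
    nlinarith
  · have h1 := (abs_le.1 (hx j (not_lt.1 hj))).2
    have h2 : ∑ i ∈ dyadicBlock j, (1 + x i ^ 2) = 2 ^ j + ∑ i ∈ dyadicBlock j, x i ^ 2 := by
      rw [Finset.sum_add_distrib]
      simp [card_dyadicBlock]
    rw [h2]
    have h3 : (0 : ℝ) < 2 ^ j := by positivity
    nlinarith

/-- For a typical centre and a small radius, typical sequences make up at most half of the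
truncated weighted ball. -/
theorem exists_truncated_ball_inter_le {K₀ : ℕ} {x : ℕ → ℝ} (hx : x ∈ typicalSet K₀) :
    ∃ r₀ : ℝ, 0 < r₀ ∧ ∀ r : ℝ, 0 < r → r ≤ r₀ → ∃ L₀ : ℕ, ∀ L ≥ L₀,
      stdGaussianSeq ({y | ∑ i ∈ Finset.range (2 ^ L - 1),
        (preissWeight i : ℝ) * (y i - x i) ^ 2 ≤ r ^ 2} ∩ typicalSet K₀) ≤
      stdGaussianSeq {y | ∑ i ∈ Finset.range (2 ^ L - 1),
        (preissWeight i : ℝ) * (y i - x i) ^ 2 ≤ r ^ 2} / 2 := by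
  obtain ⟨C, hC, hmain⟩ := exists_stdGaussianSeq_inter_le
  obtain ⟨B, hB⟩ := exists_blockBound_of_mem_typicalSet hx
  have hB0 : 0 ≤ B := by
    refine le_trans ?_ ((hB 0).trans_eq (by simp))
    exact Finset.sum_nonneg fun i _ => by positivity
  obtain ⟨K₁', hK₁'⟩ := exists_forall_exp_sub_le (C * (6 * B))
  set K₁ := max K₀ K₁' with hK₁
  set w : ℕ → ℝ := fun i => (preissWeight i : ℝ) with hw
  have hw0 : ∀ i, 0 < w i := fun i => by simp only [hw, preissWeight]; positivity
  have hwz : w 0 = 1 := by simp [hw, preissWeight]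
  -- At `θ = 4 ^ K₁` coordinate `0`, of weight `1`, alone contributes at least `θ / (1 + θ)` to the
  -- mean, and this is at least `θ r²` for such `r`. It forces the tilt parameter to be at least `4
  -- ^ K₁`.
  refine ⟨√(1 + 4 ^ K₁)⁻¹, by positivity, fun r hr hr₀ => ?_⟩
  have hr2 : r ^ 2 ≤ (1 + 4 ^ K₁)⁻¹ := by
    rw [← Real.sq_sqrt (by positivity : (0 : ℝ) ≤ (1 + 4 ^ K₁)⁻¹)]
    gcongr
  -- At `θ = 4 ^ K₂` the mean plus two deviations is `O(2 ^ K₂)`, below `θ r² = 4 ^ K₂ r²`. The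
  -- choice depends on `r` but not on the truncation `L`.
  obtain ⟨K₂', hK₂'⟩ := pow_unbounded_of_one_lt ((6 * B + 2 * √(C * (6 * B))) / r ^ 2)
    (by norm_num : (1 : ℝ) < 2)
  set K₂ := max K₁ K₂' with hK₂
  refine ⟨K₂ + 1, fun L hL => ?_⟩
  set S := Finset.range (2 ^ L - 1) with hS
  have h0S : 0 ∈ S := by
    have : 2 ^ 1 ≤ 2 ^ L := Nat.pow_le_pow_right (by norm_num) (by omega)
    rw [hS, Finset.mem_range]; omega
  let s : ℝ → ℕ → ℝ := fun θ i => θ * w i / (1 + θ * w i)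
  let G : ℝ → ℝ := fun θ => ∑ i ∈ S, s θ i * (1 + x i ^ 2 / (1 + θ * w i))
  let V : ℝ → ℝ := fun θ => C * ∑ i ∈ S, s θ i ^ 2 * (1 + x i ^ 2)
  have hden : ∀ θ : ℝ, 0 ≤ θ → ∀ i, 0 < 1 + θ * w i := fun θ hθ i => by
    have := hw0 i; positivity
  have hs0 : ∀ θ : ℝ, 0 ≤ θ → ∀ i, 0 ≤ s θ i := fun θ hθ i => by
    have := hw0 i; positivity
  have hs1 : ∀ θ : ℝ, 0 ≤ θ → ∀ i, s θ i ≤ 1 := fun θ hθ i =>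
    div_le_one_of_le₀ (by linarith) (hden θ hθ i).le
  have hsum : ∀ θ : ℝ, 0 ≤ θ → ∀ K : ℕ, θ ≤ 4 ^ (K + 1) →
      ∑ i ∈ S, s θ i * (1 + x i ^ 2) ≤ 6 * B * 2 ^ K := fun θ hθ K hK => sum_tilt_le hB hθ hK L
  have hGle : ∀ θ : ℝ, 0 ≤ θ → ∀ K : ℕ, θ ≤ 4 ^ (K + 1) → G θ ≤ 6 * B * 2 ^ K := by
    intro θ hθ K hK
    refine (Finset.sum_le_sum fun i _ => ?_).trans (hsum θ hθ K hK)
    have := hs0 θ hθ i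
    have h1 : x i ^ 2 / (1 + θ * w i) ≤ x i ^ 2 :=
      div_le_self (sq_nonneg _) (by have := hw0 i; nlinarith [mul_nonneg hθ this.le])
    gcongr
  have hVle : ∀ θ : ℝ, 0 ≤ θ → ∀ K : ℕ, θ ≤ 4 ^ (K + 1) → V θ ≤ C * (6 * B) * 2 ^ K := by
    intro θ hθ K hK
    rw [mul_assoc]
    refine mul_le_mul_of_nonneg_left ?_ hC.le
    refine (Finset.sum_le_sum fun i _ => ?_).trans (hsum θ hθ K hK)
    have := mul_le_mul_of_nonneg_left (hs1 θ hθ i) (hs0 θ hθ i)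
    rw [mul_one, ← pow_two] at this
    gcongr
  have hcont : ContinuousOn (fun θ => G θ + 2 * √(V θ) - θ * r ^ 2) (Set.Icc (4 ^ K₁) (4 ^ K₂)) := by
    have hd : ∀ θ ∈ Set.Icc ((4 : ℝ) ^ K₁) (4 ^ K₂), ∀ i, 1 + θ * w i ≠ 0 := fun θ hθ i =>
      (hden θ (le_trans (by positivity) hθ.1) i).ne'
    have hsc : ∀ i, ContinuousOn (fun θ => s θ i) (Set.Icc (4 ^ K₁) (4 ^ K₂)) := fun i =>
      ContinuousOn.div (by fun_prop) (by fun_prop) fun θ hθ => hd θ hθ i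
    have hGc : ContinuousOn G (Set.Icc (4 ^ K₁) (4 ^ K₂)) :=
      continuousOn_finsetSum _ fun i _ => (hsc i).mul (continuousOn_const.add
        (continuousOn_const.div (by fun_prop) fun θ hθ => hd θ hθ i))
    have hVc : ContinuousOn V (Set.Icc (4 ^ K₁) (4 ^ K₂)) :=
      continuousOn_const.mul (continuousOn_finsetSum _ fun i _ =>
        ((hsc i).pow 2).mul continuousOn_const)
    exact (hGc.add (continuousOn_const.mul hVc.sqrt)).sub (by fun_prop)
  have hK12 : (4 : ℝ) ^ K₁ ≤ 4 ^ K₂ := pow_le_pow_right₀ (by norm_num) (le_max_left _ _)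
  have hlow : 0 ≤ G (4 ^ K₁) + 2 * √(V (4 ^ K₁)) - 4 ^ K₁ * r ^ 2 := by
    have hθ : (0 : ℝ) ≤ 4 ^ K₁ := by positivity
    have h1 : s (4 ^ K₁) 0 * (1 + x 0 ^ 2 / (1 + 4 ^ K₁ * w 0)) ≤ G (4 ^ K₁) :=
      Finset.single_le_sum (f := fun i => s (4 ^ K₁) i * (1 + x i ^ 2 / (1 + 4 ^ K₁ * w i)))
        (fun i _ => by
          have := hs0 _ hθ i
          have := hden _ hθ i
          positivity) h0S
    have h2 : (4 : ℝ) ^ K₁ * r ^ 2 ≤ s (4 ^ K₁) 0 := by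
      simp only [s, hwz, mul_one]
      rw [div_eq_mul_inv]
      gcongr
    have h3 : s (4 ^ K₁) 0 ≤ s (4 ^ K₁) 0 * (1 + x 0 ^ 2 / (1 + 4 ^ K₁ * w 0)) := by
      have := hden _ hθ 0
      refine le_mul_of_one_le_right (hs0 _ hθ 0) ?_
      linarith [show 0 ≤ x 0 ^ 2 / (1 + 4 ^ K₁ * w 0) by positivity]
    linarith [Real.sqrt_nonneg (V (4 ^ K₁))]
  have hhigh : G (4 ^ K₂) + 2 * √(V (4 ^ K₂)) - 4 ^ K₂ * r ^ 2 ≤ 0 := by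
    have hθ : (0 : ℝ) ≤ 4 ^ K₂ := by positivity
    have hle : (4 : ℝ) ^ K₂ ≤ 4 ^ (K₂ + 1) := pow_le_pow_right₀ (by norm_num) (by omega)
    have h1 := hGle _ hθ K₂ hle
    have h2 := hVle _ hθ K₂ hle
    have h3 : √(V (4 ^ K₂)) ≤ √(C * (6 * B)) * 2 ^ K₂ := by
      rw [Real.sqrt_le_iff]
      refine ⟨by positivity, h2.trans ?_⟩
      rw [mul_pow, Real.sq_sqrt (by positivity)]
      gcongr
      exact le_self_pow₀ (one_le_pow₀ (by norm_num)) (by norm_num)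
    have h4 : (6 * B + 2 * √(C * (6 * B))) ≤ 2 ^ K₂ * r ^ 2 := by
      have h5 : (2 : ℝ) ^ K₂' ≤ 2 ^ K₂ := pow_le_pow_right₀ (by norm_num) (le_max_right _ _)
      rw [← div_le_iff₀ (by positivity)]
      exact hK₂'.le.trans h5
    have h6 : (4 : ℝ) ^ K₂ = 2 ^ K₂ * 2 ^ K₂ := by rw [← mul_pow]; norm_num
    have h7 := mul_le_mul_of_nonneg_left h4 (by positivity : (0 : ℝ) ≤ 2 ^ K₂)
    have h8 : (4 : ℝ) ^ K₂ * r ^ 2 = 2 ^ K₂ * (2 ^ K₂ * r ^ 2) := by rw [h6]; ring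
    linarith
  -- The multiplier `θ` solves `G θ + 2 √(V θ) = θ r²`: the ball of radius `r` ends exactly two
  -- deviation bounds above the tilted mean.
  obtain ⟨θ, ⟨hθ1, hθ2⟩, hθ⟩ := intermediate_value_Icc' hK12 hcont ⟨hhigh, hlow⟩
  simp only at hθ
  have hθ0 : 0 ≤ θ := le_trans (by positivity) hθ1
  have hθ1' : 1 ≤ θ := le_trans (one_le_pow₀ (by norm_num)) hθ1
  obtain ⟨K, hK, hK'⟩ := exists_nat_pow_near hθ1' (by norm_num : (1 : ℝ) < 4)
  have hKK₁ : K₁ ≤ K := by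
    have := (pow_lt_pow_iff_right₀ (by norm_num : (1 : ℝ) < 4)).1 (hθ1.trans_lt hK')
    omega
  have hKK₂ : K ≤ K₂ := (pow_le_pow_iff_right₀ (by norm_num : (1 : ℝ) < 4)).1 (hK.trans hθ2)
  -- Tilting only the coordinates in `S` keeps the tilted law absolutely continuous with an explicit
  -- density.
  let α : ℕ → ℝ≥0 := fun i => if i ∈ S then θ.toNNReal * preissWeight i else 0
  have hαS : ∀ i ∈ S, (α i : ℝ) = θ * w i := fun i hi => by
    simp [α, hi, hw, Real.coe_toNNReal _ hθ0]
  have hblock : dyadicBlock K ⊆ S := by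
    intro i hi
    have h1 : 2 ^ (K + 1) ≤ 2 ^ L := Nat.pow_le_pow_right (by norm_num) (by omega)
    simp only [dyadicBlock, Finset.mem_Ico] at hi
    rw [hS, Finset.mem_range]
    omega
  have hVpos : 0 < V θ := by
    refine mul_pos hC (Finset.sum_pos (fun i _ => ?_) ⟨0, h0S⟩)
    have h1 : 0 < s θ i := div_pos (mul_pos (by linarith) (hw0 i)) (hden θ hθ0 i)
    positivity
  have hball : {y : ℕ → ℝ | ∑ i ∈ S, w i * (y i - x i) ^ 2 ≤ r ^ 2} =
      {y | ∑ i ∈ S, (α i : ℝ) * (y i - x i) ^ 2 ≤ θ * r ^ 2} := by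
    ext y
    simp only [Set.mem_ofPred_eq]
    have : ∑ i ∈ S, (α i : ℝ) * (y i - x i) ^ 2 = θ * ∑ i ∈ S, w i * (y i - x i) ^ 2 := by
      rw [Finset.mul_sum]
      exact Finset.sum_congr rfl fun i hi => by rw [hαS i hi]; ring
    rw [this]
    exact (mul_le_mul_iff_right₀ (by linarith)).symm
  have hcmp := hmain α x S (√(V θ)) (θ * r ^ 2) (typicalSet K₀)
    (fun i hi => by simp [α, hi]) (Real.sqrt_pos.2 hVpos) (measurableSet_typicalSet K₀)
    (by
      rw [Real.sq_sqrt hVpos.le]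
      refine le_of_eq ?_
      simp only [V, s]
      congr 1
      exact Finset.sum_congr rfl fun i hi => by rw [hαS i hi])
    (by
      have : ∑ i ∈ S, (α i : ℝ) / (1 + α i) * (1 + x i ^ 2 / (1 + α i)) = G θ :=
        Finset.sum_congr rfl fun i hi => by rw [hαS i hi]
      rw [this]
      linarith)
  have hKK₀ : K₀ ≤ K := (le_max_left _ _).trans hKK₁
  have hcher : tiltedSeq α x (typicalSet K₀) ≤ ENNReal.ofReal (Real.exp (-(2 : ℝ) ^ K / 1000)) := by
    have h4 : (0 : ℝ) < 4 ^ K := by positivity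
    have := tiltedSeq_sum_sq_ge_le α x (dyadicBlock K) (β := θ.toNNReal * (4 ^ K)⁻¹)
      (by
        rw [← NNReal.coe_le_coe]
        push_cast
        rw [Real.coe_toNNReal _ hθ0, ← div_eq_mul_inv, le_div_iff₀ h4, one_mul]
        exact hK)
      (by
        rw [← NNReal.coe_le_coe]
        push_cast
        rw [Real.coe_toNNReal _ hθ0, ← div_eq_mul_inv, div_le_iff₀ h4]
        rw [pow_succ'] at hK'
        exact hK'.le)
      (fun i hi => by simp [α, hblock hi, preissWeight_of_mem hi])
      (by
        have := (abs_le.1 (hx K hKK₀)).2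
        rw [card_dyadicBlock]
        push_cast
        linarith)
    rw [card_dyadicBlock] at this
    push_cast at this
    refine (measure_mono fun y hy => ?_).trans this
    have := (abs_le.1 (hy K hKK₀)).1
    simp only [Set.mem_ofPred_eq]
    linarith
  have hfac : tiltedSeq α x (typicalSet K₀) * ENNReal.ofReal (Real.exp (2 * √(V θ))) ≤
      ENNReal.ofReal (3 / 8) := by
    refine (mul_le_mul_left hcher _).trans ?_
    rw [← ENNReal.ofReal_mul (Real.exp_pos _).le, ← Real.exp_add]
    refine ENNReal.ofReal_le_ofReal (le_trans (Real.exp_le_exp.2 ?_)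
      (hK₁' K ((le_max_right _ _).trans hKK₁)))
    have := Real.sqrt_le_sqrt (hVle θ hθ0 K hK'.le)
    linarith
  rw [hball]
  have h38 : ENNReal.ofReal (3 / 8) = (2 : ℝ≥0∞)⁻¹ * (3 / 4) := by
    rw [show (3 / 8 : ℝ) = 2⁻¹ * (3 / 4) by norm_num, ENNReal.ofReal_mul (by norm_num),
      ENNReal.ofReal_inv_of_pos (by norm_num), ENNReal.ofReal_div_of_pos (by norm_num)]
    simp
  have hfin := hcmp.trans (mul_le_mul_left hfac _)
  rw [h38, mul_right_comm] at hfin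
  have h34 : (3 / 4 : ℝ≥0∞) ≠ 0 := by simp
  have h34' : (3 / 4 : ℝ≥0∞) ≠ ∞ := ENNReal.div_ne_top (by simp) (by simp)
  rw [ENNReal.div_eq_inv_mul]
  exact (ENNReal.mul_le_mul_iff_left h34 h34').1 hfin

/-- Chebyshev bounds the probability that block `K` is atypical by a multiple of `2⁻ᴷ`, which is
summable. By Borel–Cantelli the sets `typicalSet K₀` have a union of full measure. -/
theorem exists_stdGaussianSeq_typicalSet_pos : ∃ K₀, 0 < stdGaussianSeq (typicalSet K₀) := by
  obtain ⟨C, hC, hvar⟩ := exists_variance_sub_sq_gaussianReal_le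
  set bad : ℕ → Set (ℕ → ℝ) := fun K =>
    {y | 2 ^ K / 50 ≤ |∑ i ∈ dyadicBlock K, y i ^ 2 - 2 ^ K|} with hbad
  have hle : ∀ K, stdGaussianSeq (bad K) ≤ ENNReal.ofReal (2500 * C * (1 / 2) ^ K) := by
    intro K
    have h := infinitePi_le_abs_sum_sub (fun _ => gaussianReal 0 1) (dyadicBlock K)
      (F := fun _ t => t ^ 2) (fun i => by fun_prop)
      (fun i => by simpa using memLp_sub_sq_gaussianReal 0 1 0)
      (c := 2 ^ K / 50) (by positivity)
    have h1 : ∫ t, t ^ 2 ∂gaussianReal 0 1 = 1 := by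
      simpa using integral_sub_sq_gaussianReal 0 1 0
    simp only [h1, Finset.sum_const, card_dyadicBlock, nsmul_eq_mul, mul_one, Nat.cast_pow,
      Nat.cast_ofNat] at h
    refine h.trans (ENNReal.ofReal_le_ofReal ?_)
    have h2 : Var[fun t => t ^ 2; gaussianReal 0 1] ≤ C := by simpa using hvar 0 1 0
    rw [div_le_iff₀ (by positivity)]
    calc (2 : ℝ) ^ K * Var[fun t => t ^ 2; gaussianReal 0 1] ≤ 2 ^ K * C := by gcongr
      _ = _ := by rw [one_div_pow]; field_simp; norm_num
  have hsum : ∑' K, stdGaussianSeq (bad K) ≠ ∞ := by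
    refine ne_top_of_le_ne_top ?_ (ENNReal.tsum_le_tsum hle)
    have hs : Summable fun K : ℕ => 2500 * C * (1 / 2 : ℝ) ^ K :=
      (summable_geometric_of_lt_one (by norm_num) (by norm_num)).mul_left _
    rw [← ENNReal.ofReal_tsum_of_nonneg (fun K => by positivity) hs]
    exact ENNReal.ofReal_ne_top
  have hae := ae_eventually_notMem hsum
  by_contra! hcon
  have h0 : stdGaussianSeq (⋃ K₀, typicalSet K₀) = 0 :=
    measure_iUnion_null fun K₀ => le_antisymm (hcon K₀) zero_le
  have h1 : ∀ᵐ y ∂stdGaussianSeq, y ∈ ⋃ K₀, typicalSet K₀ := by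
    filter_upwards [hae] with y hy
    obtain ⟨K₀, hK₀⟩ := Filter.eventually_atTop.1 hy
    refine Set.mem_iUnion.2 ⟨K₀, fun K hK => ?_⟩
    have := hK₀ K hK
    simp only [hbad, Set.mem_ofPred_eq, not_le] at this
    exact this.le
  have h2 := prob_compl_eq_zero_iff₀ (μ := stdGaussianSeq) (s := ⋃ K₀, typicalSet K₀)
    (MeasurableSet.iUnion measurableSet_typicalSet).nullMeasurableSet
  rw [h2.1 h1] at h0
  exact one_ne_zero h0

/-! ### From truncated balls to balls of the Hilbert space -/

section

variable {H : Type*} [NormedAddCommGroup H] [InnerProductSpace ℝ H] [MeasurableSpace H]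
  {γ : Measure H} {T : H →ₗ[ℝ] (ℕ → ℝ)}

theorem IsWeightedGaussianSpace.norm_le_iff {w : ℕ → ℝ} (hT : IsWeightedGaussianSpace γ w T)
    (h : H) {r : ℝ} (hr : 0 ≤ r) :
    ‖h‖ ≤ r ↔ ∀ L : ℕ, ∑ i ∈ Finset.range (2 ^ L - 1), w i * T h i ^ 2 ≤ r ^ 2 := by
  have hs : Summable fun i => w i * T h i ^ 2 := by
    have : T h ∈ Set.range T := ⟨h, rfl⟩
    rwa [hT.range_eq] at this
  have h0 : ∀ i, 0 ≤ w i * T h i ^ 2 := fun i => mul_nonneg (hT.pos i).le (sq_nonneg _)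
  rw [hT.norm_eq, Real.sqrt_le_left hr]
  refine ⟨fun hle L => (hs.sum_le_tsum _ fun i _ => h0 i).trans hle, fun hle => ?_⟩
  refine Real.tsum_le_of_sum_range_le h0 fun n => ?_
  refine le_trans (Finset.sum_le_sum_of_subset_of_nonneg (Finset.range_subset_range.2 ?_)
    fun i _ _ => h0 i) (hle n)
  have := Nat.lt_two_pow_self (n := n)
  omega

theorem IsWeightedGaussianSpace.measure_preimage {w : ℕ → ℝ}
    (hT : IsWeightedGaussianSpace γ w T) {A : Set (ℕ → ℝ)} (hA : MeasurableSet A) :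
    γ (T ⁻¹' A) = stdGaussianSeq A := by
  rw [← hT.map_eq, Measure.map_apply hT.measurable hA]

theorem IsWeightedGaussianSpace.isProbabilityMeasure {w : ℕ → ℝ}
    (hT : IsWeightedGaussianSpace γ w T) : IsProbabilityMeasure γ :=
  ⟨by rw [← Set.preimage_univ (f := T), hT.measure_preimage .univ, measure_univ]⟩

/-- The measure of a closed ball, intersected with a cylinder event, as a limit over
finite-dimensional truncations. -/
theorem IsWeightedGaussianSpace.tendsto_truncated_ball {w : ℕ → ℝ}
    (hT : IsWeightedGaussianSpace γ w T) (x : H) {r : ℝ} (hr : 0 ≤ r) {A : Set (ℕ → ℝ)}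
    (hA : MeasurableSet A) :
    Filter.Tendsto (fun L : ℕ => stdGaussianSeq ({y | ∑ i ∈ Finset.range (2 ^ L - 1),
      w i * (y i - T x i) ^ 2 ≤ r ^ 2} ∩ A)) Filter.atTop
      (nhds (γ (closedBall x r ∩ T ⁻¹' A))) := by
  set E : ℕ → Set (ℕ → ℝ) := fun L =>
    {y | ∑ i ∈ Finset.range (2 ^ L - 1), w i * (y i - T x i) ^ 2 ≤ r ^ 2} ∩ A with hE
  have hEm : ∀ L, MeasurableSet (E L) := fun L =>
    (measurableSet_le (by fun_prop) measurable_const).inter hA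
  have hanti : Antitone E := by
    intro L L' hLL' y hy
    refine ⟨le_trans (Finset.sum_le_sum_of_subset_of_nonneg (Finset.range_subset_range.2 ?_)
      fun i _ _ => mul_nonneg (hT.pos i).le (sq_nonneg _)) hy.1, hy.2⟩
    exact Nat.sub_le_sub_right (Nat.pow_le_pow_right (by norm_num) hLL') 1
  have hball : closedBall x r ∩ T ⁻¹' A = T ⁻¹' ⋂ L, E L := by
    ext h
    simp only [Set.mem_inter_iff, mem_closedBall, dist_eq_norm, Set.mem_preimage, Set.mem_iInter,
      hE, Set.mem_ofPred_eq, hT.norm_le_iff _ hr, map_sub, Pi.sub_apply]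
    exact ⟨fun hh L => ⟨hh.1 L, hh.2⟩, fun hh => ⟨fun L => (hh L).1, (hh 0).2⟩⟩
  rw [hball, hT.measure_preimage (MeasurableSet.iInter hEm)]
  exact tendsto_measure_iInter_atTop (fun L => (hEm L).nullMeasurableSet) hanti
    ⟨0, measure_ne_top _ _⟩

/-- For a typical centre, typical points fill at most half of each sufficiently small ball. -/
theorem IsWeightedGaussianSpace.exists_ball_inter_le
    (hT : IsWeightedGaussianSpace γ (fun i => (preissWeight i : ℝ)) T) {K₀ : ℕ} {x : H}
    (hx : T x ∈ typicalSet K₀) :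
    ∃ r₀ : ℝ, 0 < r₀ ∧ ∀ r : ℝ, 0 < r → r ≤ r₀ →
      γ (closedBall x r ∩ T ⁻¹' typicalSet K₀) ≤ γ (closedBall x r) / 2 := by
  obtain ⟨r₀, hr₀, hr⟩ := exists_truncated_ball_inter_le hx
  refine ⟨r₀, hr₀, fun r h0 h1 => ?_⟩
  obtain ⟨L₀, hL₀⟩ := hr r h0 h1
  have hl := hT.tendsto_truncated_ball x h0.le (measurableSet_typicalSet K₀)
  have hu := hT.tendsto_truncated_ball x h0.le MeasurableSet.univ
  simp only [Set.inter_univ, Set.preimage_univ] at hu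
  exact le_of_tendsto_of_tendsto hl (ENNReal.Tendsto.div_const hu (Or.inr (by norm_num)))
    (Filter.eventually_atTop.2 ⟨L₀, hL₀⟩)

end

/-! ### The centred maximal function of the typical set -/

/-- If a measurable set `A` fills at most half of all small balls around a point `x` of the
support, then the centred maximal function of its indicator is less than `1` at `x`. -/
theorem centeredMaximal_indicator_lt_one {X : Type*} [PseudoMetricSpace X] [MeasurableSpace X]
    [OpensMeasurableSpace X] {μ : Measure X} [IsProbabilityMeasure μ] {A : Set X}
    (hA : MeasurableSet A) {x : X} (hx : x ∈ μ.support) {r₀ : ℝ} (hr₀ : 0 < r₀)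
    (h : ∀ r : ℝ, 0 < r → r ≤ r₀ → μ (closedBall x r ∩ A) ≤ μ (closedBall x r) / 2) :
    centeredMaximal μ (A.indicator 1) x < 1 := by
  have hpos : ∀ r : ℝ, 0 < r → 0 < μ (closedBall x r) := fun r hr =>
    (Measure.mem_support_iff_forall x).1 hx _ (closedBall_mem_nhds x hr)
  have hlt : max (2⁻¹ : ℝ≥0∞) (1 - μ (closedBall x r₀) / 2) < 1 := by
    refine max_lt ENNReal.one_half_lt_one (ENNReal.sub_lt_self (by simp) (by simp) ?_)
    exact (ENNReal.half_pos (hpos r₀ hr₀).ne').ne'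
  refine lt_of_le_of_lt (iSup₂_le fun r hr => ?_) hlt
  have hint : ∫⁻ y in closedBall x r, ‖A.indicator (1 : X → ℝ) y‖ₑ ∂μ = μ (closedBall x r ∩ A) := by
    have : ∀ y, ‖A.indicator (1 : X → ℝ) y‖ₑ = A.indicator 1 y := fun y => by
      by_cases hy : y ∈ A <;> simp [hy]
    simp_rw [this]
    rw [lintegral_indicator_one hA, Measure.restrict_apply hA, Set.inter_comm]
  rw [hint]
  refine ENNReal.div_le_of_le_mul ?_
  by_cases hrr : r ≤ r₀
  · refine (h r hr hrr).trans ?_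
    rw [ENNReal.div_eq_inv_mul]
    gcongr
    exact le_max_left _ _
  · push Not at hrr
    -- A ball of radius `r > r₀` misses `A` on mass at least `a`, and `μ (closedBall x r) - a ≤ (1 -
    -- a) * μ (closedBall x r)` because `μ` has total mass one.
    set a := μ (closedBall x r₀) / 2 with ha
    have h1 : a ≤ μ (closedBall x r₀ \ A) := by
      have h2 := measure_inter_add_sdiff (μ := μ) (closedBall x r₀) hA
      have h3 := h r₀ hr₀ le_rfl
      have h4 : a + a = μ (closedBall x r₀) := ENNReal.add_halves _
      have h5 : a + a ≤ a + μ (closedBall x r₀ \ A) := by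
        rw [h4, ← h2]; gcongr
      exact (ENNReal.add_le_add_iff_left
        (ENNReal.div_ne_top (measure_ne_top _ _) (by norm_num))).1 h5
    have h6 : μ (closedBall x r ∩ A) + a ≤ μ (closedBall x r) := by
      rw [← measure_inter_add_sdiff (closedBall x r) hA]
      gcongr
      refine h1.trans (measure_mono ?_)
      gcongr
    have h7 : μ (closedBall x r ∩ A) ≤ μ (closedBall x r) - a :=
      ENNReal.le_sub_of_add_le_right
        (ENNReal.div_ne_top (measure_ne_top _ _) (by norm_num)) h6
    refine h7.trans (le_trans ?_ (mul_le_mul_left (le_max_right _ _) _))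
    rw [ENNReal.sub_mul fun _ _ => measure_ne_top _ _, one_mul]
    gcongr
    exact mul_le_of_le_one_right zero_le prob_le_one

theorem exists_centeredMaximal_lt {H : Type*} [NormedAddCommGroup H] [InnerProductSpace ℝ H]
    [TopologicalSpace.SeparableSpace H] [MeasurableSpace H] [BorelSpace H] {γ : Measure H}
    {T : H →ₗ[ℝ] (ℕ → ℝ)}
    (hT : IsWeightedGaussianSpace γ (fun i => (preissWeight i : ℝ)) T) :
    ∃ f : H → ℝ, LocallyIntegrable f γ ∧
      ∃ A : Set H, MeasurableSet A ∧ 0 < γ A ∧ ∀ x ∈ A, centeredMaximal γ f x < ‖f x‖ₑ := by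
  have := hT.isProbabilityMeasure
  have : SecondCountableTopology H := UniformSpace.secondCountable_of_separable H
  obtain ⟨K₀, hK₀⟩ := exists_stdGaussianSeq_typicalSet_pos
  set A := T ⁻¹' typicalSet K₀ with hAdef
  have hA : MeasurableSet A := hT.measurable (measurableSet_typicalSet K₀)
  -- Passing to the support costs a null set and makes every ball around the chosen points have
  -- positive measure.
  refine ⟨A.indicator 1, ((integrable_const (1 : ℝ)).indicator hA).locallyIntegrable,
    A ∩ γ.support, hA.inter Measure.isClosed_support.measurableSet, ?_, fun x hx => ?_⟩
  · rw [measure_inter_conull Measure.measure_compl_support]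
    rwa [hAdef, hT.measure_preimage (measurableSet_typicalSet K₀)]
  · obtain ⟨r₀, hr₀, hr⟩ := hT.exists_ball_inter_le hx.1
    simpa [hx.1] using centeredMaximal_indicator_lt_one hA hx.2 hr₀ hr

/-! ### Fixed points of the uncentred maximal operator -/

/-- A locally integrable fixed point of the uncentred maximal operator is constant on each ball. -/
theorem IsMaximalFixedPoint.ae_eq_const_on_closedBall {X : Type*} [PseudoMetricSpace X]
    [MeasurableSpace X] [OpensMeasurableSpace X] {μ : Measure X} [IsFiniteMeasure μ] {f : X → ℝ}
    (hm : AEStronglyMeasurable f μ) (hf : IsMaximalFixedPoint μ f) (z : X) {r : ℝ} (hr : 0 < r)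
    (hpos : 0 < μ (closedBall z r)) :
    ∃ c : ℝ, ∀ᵐ x ∂μ.restrict (closedBall z r), f x = c := by
  set B := closedBall z r with hB
  have hBm : MeasurableSet B := measurableSet_closedBall
  set a : ℝ≥0∞ := (∫⁻ y in B, ‖f y‖ₑ ∂μ) / μ B with ha
  have hle : ∀ᵐ x ∂μ.restrict B, f x = ‖f x‖ ∧ a ≤ ‖f x‖ₑ := by
    rw [ae_restrict_iff' hBm]
    filter_upwards [hf] with x hx hxB
    have h0 : 0 ≤ f x := by
      have : (0 : EReal) ≤ (f x : EReal) := hx ▸ EReal.coe_ennreal_nonneg _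
      exact_mod_cast this
    refine ⟨(Real.norm_of_nonneg h0).symm, ?_⟩
    have h1 : a ≤ uncenteredMaximal μ f x :=
      le_iSup_of_le z (le_iSup_of_le r (le_iSup_of_le hr (le_iSup_of_le hxB le_rfl)))
    refine h1.trans_eq ?_
    rw [Real.enorm_of_nonneg h0]
    rw [← EReal.coe_ennreal_eq_coe_ennreal_iff, hx, EReal.coe_ennreal_ofReal, max_eq_left h0]
  have hne : μ.restrict B ≠ 0 := by
    rw [Ne, Measure.restrict_eq_zero]; exact hpos.ne'
  -- Local integrability need not give integrability on a whole ball; finiteness of the average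
  -- comes from `a ≤ ‖f x‖ₑ` at a single point.
  have hat : a ≠ ∞ := by
    have : (ae (μ.restrict B)).NeBot := ae_neBot.2 hne
    obtain ⟨x, hx⟩ := hle.exists
    exact ne_top_of_le_ne_top enorm_ne_top hx.2
  have hint : ∫⁻ y in B, ‖f y‖ₑ ∂μ = ∫⁻ _ in B, a ∂μ := by
    rw [setLIntegral_const, ha, ENNReal.div_mul_cancel hpos.ne' (measure_ne_top _ _)]
  have heq : (fun _ => a) =ᵐ[μ.restrict B] fun x => ‖f x‖ₑ := by
    refine ae_eq_of_ae_le_of_lintegral_le (hle.mono fun x hx => hx.2) ?_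
      hm.enorm.restrict hint.le
    rw [setLIntegral_const]
    exact ENNReal.mul_ne_top hat (measure_ne_top _ _)
  refine ⟨a.toReal, ?_⟩
  filter_upwards [hle, heq] with x hx hx'
  rw [hx.1, hx']
  simp

theorem IsMaximalFixedPoint.ae_eq_const {X : Type*} [PseudoMetricSpace X]
    [MeasurableSpace X] [OpensMeasurableSpace X] {μ : Measure X} [IsFiniteMeasure μ] {f : X → ℝ}
    (hm : AEStronglyMeasurable f μ) (hf : IsMaximalFixedPoint μ f) :
    ∃ c : ℝ, ∀ᵐ x ∂μ, f x = c := by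
  rcases eq_or_ne μ 0 with rfl | hμ
  · exact ⟨0, by simp⟩
  obtain ⟨z⟩ : Nonempty X := by
    by_contra hne
    rw [not_nonempty_iff] at hne
    exact hμ (Measure.eq_zero_of_isEmpty μ)
  have hU : ⋃ n : ℕ, closedBall z n = Set.univ := iUnion_closedBall_nat z
  obtain ⟨N, hN⟩ : ∃ N : ℕ, 0 < μ (closedBall z N) := by
    by_contra! hcon
    refine hμ (Measure.measure_univ_eq_zero.1 ?_)
    rw [← hU]
    exact measure_iUnion_null fun n => le_antisymm (hcon n) zero_le
  have hsub : ∀ n : ℕ, closedBall z N ⊆ closedBall z ((N + n + 1 : ℕ) : ℝ) := fun n =>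
    closedBall_subset_closedBall (by push_cast; linarith [n.cast_nonneg (α := ℝ)])
  -- The balls all contain one fixed ball of positive measure, so their constants agree. The `+ 1`
  -- keeps radii positive when `N = 0`.
  choose c hc using fun n : ℕ => hf.ae_eq_const_on_closedBall hm z
    (r := ((N + n + 1 : ℕ) : ℝ)) (by positivity) (hN.trans_le (measure_mono (hsub n)))
  have hcc : ∀ n, c n = c 0 := by
    intro n
    have : (ae (μ.restrict (closedBall z (N : ℝ)))).NeBot :=
      ae_neBot.2 (by rw [Ne, Measure.restrict_eq_zero]; exact hN.ne')
    obtain ⟨x, hx⟩ := ((ae_restrict_of_ae_restrict_of_subset (hsub n) (hc n)).and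
      (ae_restrict_of_ae_restrict_of_subset (hsub 0) (hc 0))).exists
    exact hx.1.symm.trans hx.2
  refine ⟨c 0, ?_⟩
  have hall : ∀ᵐ x ∂μ, ∀ n : ℕ, x ∈ closedBall z ((N + n + 1 : ℕ) : ℝ) → f x = c 0 := by
    rw [ae_all_iff]
    intro n
    rw [← ae_restrict_iff' measurableSet_closedBall, ← hcc n]
    exact hc n
  filter_upwards [hall] with x hx
  obtain ⟨n, hn⟩ := Set.mem_iUnion.1 (hU ▸ Set.mem_univ x : x ∈ ⋃ n : ℕ, closedBall z (n : ℝ))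
  exact hx n (closedBall_subset_closedBall (by push_cast; linarith [N.cast_nonneg (α := ℝ)]) hn)

/-! ### Realisation of the Gaussian measure on `ℓ²` -/

/-- A pointwise limit of centred Gaussian variables with convergent variances is Gaussian. -/
theorem map_eq_gaussianReal_of_tendsto {Ω : Type*} [MeasurableSpace Ω] {P : Measure Ω}
    [IsProbabilityMeasure P] {X : ℕ → Ω → ℝ} {Y : Ω → ℝ} (hX : ∀ n, Measurable (X n))
    (hY : Measurable Y) (hlim : ∀ ω, Filter.Tendsto (fun n => X n ω) Filter.atTop (nhds (Y ω)))
    {v : ℕ → ℝ≥0} {v' : ℝ≥0} (hv : Filter.Tendsto v Filter.atTop (nhds v'))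
    (h : ∀ n, P.map (X n) = gaussianReal 0 (v n)) :
    P.map Y = gaussianReal 0 v' := by
  have : IsProbabilityMeasure (P.map Y) := Measure.isProbabilityMeasure_map hY.aemeasurable
  refine Measure.ext_of_charFun (funext fun t => ?_)
  have h1 : ∀ n, charFun (P.map (X n)) t = ∫ ω, Complex.exp (t * X n ω * Complex.I) ∂P := fun n => by
    rw [charFun_apply_real, integral_map (hX n).aemeasurable (by fun_prop)]
  have h2 : charFun (P.map Y) t = ∫ ω, Complex.exp (t * Y ω * Complex.I) ∂P := by
    rw [charFun_apply_real, integral_map hY.aemeasurable (by fun_prop)]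
  have h3 : Filter.Tendsto (fun n => charFun (P.map (X n)) t) Filter.atTop
      (nhds (charFun (P.map Y) t)) := by
    simp_rw [h1]
    rw [h2]
    refine tendsto_integral_of_dominated_convergence (fun _ => 1)
      (fun n => by have := hX n; fun_prop) (integrable_const _)
      (fun n => Filter.Eventually.of_forall fun ω => ?_)
      (Filter.Eventually.of_forall fun ω => ?_)
    · rw [← Complex.ofReal_mul, Complex.norm_exp_ofReal_mul_I]
    · have hc : Continuous fun u : ℝ => Complex.exp (t * u * Complex.I) := by fun_prop
      exact (hc.tendsto _).comp (hlim ω)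
  have h4 : Filter.Tendsto (fun n => charFun (P.map (X n)) t) Filter.atTop
      (nhds (charFun (gaussianReal 0 v') t)) := by
    simp_rw [h, charFun_gaussianReal]
    have hc : Continuous fun u : ℝ≥0 =>
        Complex.exp (t * (0 : ℝ) * Complex.I - ((u : ℝ) : ℂ) * t ^ 2 / 2) := by fun_prop
    exact (hc.tendsto _).comp hv
  exact tendsto_nhds_unique h3 h4

theorem stdGaussianSeq_map_sum (b : ℕ → ℝ) (S : Finset ℕ) :
    stdGaussianSeq.map (fun y => ∑ i ∈ S, b i * y i) =
      gaussianReal 0 (∑ i ∈ S, (b i ^ 2).toNNReal) := by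
  have hm : Measurable fun y : ℕ → ℝ => ∑ i ∈ S, b i * y i := by fun_prop
  have : IsProbabilityMeasure (stdGaussianSeq.map fun y : ℕ → ℝ => ∑ i ∈ S, b i * y i) :=
    Measure.isProbabilityMeasure_map hm.aemeasurable
  refine Measure.ext_of_charFun (funext fun t => ?_)
  have hind : iIndepFun (fun i (y : ℕ → ℝ) => b i * y i) stdGaussianSeq :=
    iIndepFun_infinitePi (X := fun i t => b i * t) fun i => by fun_prop
  have h1 := iIndepFun.charFun_map_fun_finsetSum_eq_prod (s := S)
    (X := fun i (y : ℕ → ℝ) => b i * y i) (fun i _ => Measurable.aemeasurable (by fun_prop)) (hind.restrict S)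
  have h2 : ∀ i, stdGaussianSeq.map (fun y => b i * y i) = gaussianReal 0 (b i ^ 2).toNNReal := by
    intro i
    have := Measure.map_map (μ := stdGaussianSeq) (f := fun y : ℕ → ℝ => y i)
      (g := fun t => b i * t) (by fun_prop) (by fun_prop)
    rw [Function.comp_def] at this
    rw [← this, show stdGaussianSeq.map (fun y : ℕ → ℝ => y i) = gaussianReal 0 1 from
      Measure.infinitePi_map_eval _ i, gaussianReal_map_const_mul]
    congr 1
    · simp
    · ext; simp [sq_nonneg]
  rw [h1, Finset.prod_apply]
  simp_rw [h2, charFun_gaussianReal]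
  rw [← Complex.exp_sum]
  congr 1
  push_cast
  simp [Finset.sum_neg_distrib, Finset.sum_mul, Finset.sum_div]

/-- The real sequence space `ℓ²`. -/
abbrev RealEllTwo : Type := lp (fun _ : ℕ => ℝ) 2

instance : TopologicalSpace.SeparableSpace RealEllTwo := by
  rw [← TopologicalSpace.isSeparable_univ_iff]
  have hr : (Set.range fun i => (lp.single 2 i (1 : ℝ) : RealEllTwo)).Countable :=
    Set.countable_range _
  refine (hr.isSeparable.span (R := ℝ)).closure.mono fun f _ => ?_
  refine mem_closure_of_tendsto (lp.hasSum_single (by norm_num) f)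
    (Filter.Eventually.of_forall fun s => ?_)
  refine Submodule.sum_mem _ fun i _ => ?_
  have : lp.single 2 i (f i) = f i • (lp.single 2 i (1 : ℝ) : RealEllTwo) := by
    rw [← lp.single_smul, smul_eq_mul, mul_one]
  rw [this]
  exact Submodule.smul_mem _ _ (Submodule.subset_span ⟨i, rfl⟩)

noncomputable instance : MeasurableSpace RealEllTwo := borel _

instance : BorelSpace RealEllTwo := ⟨rfl⟩

theorem preissWeight_pos (i : ℕ) : 0 < preissWeight i := by
  unfold preissWeight; positivity

theorem antitone_preissWeight : Antitone preissWeight := by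
  intro i j hij
  unfold preissWeight
  exact inv_anti₀ (by positivity)
    (pow_le_pow_right₀ (by norm_num) (Nat.log_mono_right (by omega)))

theorem summable_preissWeight : Summable fun i => (preissWeight i : ℝ) := by
  have h : Summable fun i : ℕ => 4 * (1 / ((i + 1 : ℕ) : ℝ) ^ 2) :=
    ((summable_nat_add_iff 1).2 (Real.summable_one_div_nat_pow.2 (by norm_num))).mul_left 4
  refine h.of_nonneg_of_le (fun i => (preissWeight i).2) fun i => ?_
  have h1 : ((i + 1 : ℕ) : ℝ) ≤ 2 ^ (Nat.log 2 (i + 1) + 1) := by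
    exact_mod_cast (Nat.lt_pow_succ_log_self (by norm_num) (i + 1)).le
  rw [preissWeight]
  push_cast at h1 ⊢
  rw [← one_div, mul_one_div, div_le_div_iff₀ (by positivity) (by positivity), one_mul]
  calc ((i : ℝ) + 1) ^ 2 ≤ (2 ^ (Nat.log 2 (i + 1) + 1)) ^ 2 := by gcongr
    _ = 4 * 4 ^ Nat.log 2 (i + 1) := by
      rw [← pow_mul, mul_comm, pow_mul, pow_succ']; norm_num

/-- The linear map sending `h ∈ ℓ²` to the sequence `hᵢ / √wᵢ`, where `w` are the weights. -/
noncomputable def preissMap : RealEllTwo →ₗ[ℝ] (ℕ → ℝ) where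
  toFun h i := h i / √(preissWeight i)
  map_add' f g := by ext i; simp [add_div]
  map_smul' c f := by ext i; simp [mul_div_assoc]

theorem preissMap_apply (h : RealEllTwo) (i : ℕ) : preissMap h i = h i / √(preissWeight i) := rfl

theorem preissWeight_mul_sq (i : ℕ) (t : ℝ) : (preissWeight i : ℝ) * (t / √(preissWeight i)) ^ 2 =
    t ^ 2 := by
  have h : (0 : ℝ) < preissWeight i := preissWeight_pos i
  rw [div_pow, Real.sq_sqrt h.le]
  field_simp

theorem continuous_preissMap : Continuous preissMap := by
  refine continuous_pi fun i => ?_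
  have h : Continuous fun h : RealEllTwo => h i :=
    (continuous_apply i).comp (lp.uniformContinuous_coe (E := fun _ : ℕ => ℝ) (p := 2)).continuous
  exact h.div_const _

theorem injective_preissMap : Function.Injective preissMap := by
  intro f g hfg
  ext i
  have := congrFun hfg i
  have hw : (√(preissWeight i) : ℝ) ≠ 0 := (Real.sqrt_pos.2 (preissWeight_pos i)).ne'
  rwa [preissMap_apply, preissMap_apply, div_left_inj' hw] at this

theorem range_preissMap :
    Set.range preissMap = {x : ℕ → ℝ | Summable fun i => (preissWeight i : ℝ) * x i ^ 2} := by
  ext x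
  constructor
  · rintro ⟨h, rfl⟩
    have := (memℓp_gen_iff (by norm_num)).1 (lp.memℓp h)
    simpa [preissMap_apply, preissWeight_mul_sq] using this
  · intro hx
    have hm : Memℓp (fun i => √(preissWeight i) * x i) 2 := by
      refine memℓp_gen ?_
      simpa [mul_pow] using hx
    refine ⟨⟨_, hm⟩, ?_⟩
    ext i
    have hw : (√(preissWeight i) : ℝ) ≠ 0 := (Real.sqrt_pos.2 (preissWeight_pos i)).ne'
    rw [preissMap_apply]
    exact mul_div_cancel_left₀ _ hw

theorem norm_eq_preissMap (h : RealEllTwo) :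
    ‖h‖ = √(∑' i, (preissWeight i : ℝ) * preissMap h i ^ 2) := by
  rw [lp.norm_eq_tsum_rpow (by norm_num), Real.sqrt_eq_rpow]
  simp [preissMap_apply, preissWeight_mul_sq]

/-- A continuous injection of a Polish space is a Borel embedding (Lusin–Souslin), so the product
measure can be pulled back along it. -/
theorem measurableEmbedding_preissMap : MeasurableEmbedding preissMap := by
  have : SecondCountableTopology RealEllTwo := UniformSpace.secondCountable_of_separable _
  exact continuous_preissMap.measurableEmbedding injective_preissMap

/-- The expectation of `∑ wᵢ xᵢ²` is `∑ wᵢ < ∞`, so the series converges almost surely. -/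
theorem ae_mem_range_preissMap : ∀ᵐ x ∂stdGaussianSeq, x ∈ Set.range preissMap := by
  have h1 : ∀ i, ∫⁻ x : ℕ → ℝ, ENNReal.ofReal ((preissWeight i : ℝ) * x i ^ 2) ∂stdGaussianSeq =
      ENNReal.ofReal (preissWeight i) := by
    intro i
    have hint : Integrable (fun t : ℝ => t ^ 2) (gaussianReal 0 1) := by
      simpa using integrable_sub_pow_gaussianReal 0 1 0 2
    have h2 := (measurePreserving_eval_infinitePi (fun _ : ℕ => gaussianReal 0 1) i).lintegral_comp
      (f := fun t => ENNReal.ofReal ((preissWeight i : ℝ) * t ^ 2)) (by fun_prop)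
    refine h2.trans ?_
    rw [← ofReal_integral_eq_lintegral_ofReal (hint.const_mul _)
      (Filter.Eventually.of_forall fun t => by positivity), integral_const_mul]
    have h3 : ∫ t, t ^ 2 ∂gaussianReal 0 1 = 1 := by
      simpa using integral_sub_sq_gaussianReal 0 1 0
    rw [h3, mul_one]
  have h4 : ∫⁻ x : ℕ → ℝ, ∑' i, ENNReal.ofReal ((preissWeight i : ℝ) * x i ^ 2) ∂stdGaussianSeq ≠
      ∞ := by
    rw [lintegral_tsum fun i => Measurable.aemeasurable (by fun_prop)]
    simp_rw [h1]
    rw [← ENNReal.ofReal_tsum_of_nonneg (fun i => NNReal.coe_nonneg _) summable_preissWeight]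
    exact ENNReal.ofReal_ne_top
  filter_upwards [ae_lt_top (by fun_prop) h4] with x hx
  rw [range_preissMap]
  have := ENNReal.summable_toReal hx.ne
  refine this.congr fun i => ?_
  rw [ENNReal.toReal_ofReal (by positivity)]

/-- The Gaussian measure of Preiss's example, carried over to `ℓ²`. -/
noncomputable def preissGaussian : Measure RealEllTwo := stdGaussianSeq.comap preissMap

theorem isWeightedGaussianSpace_preissGaussian :
    IsWeightedGaussianSpace preissGaussian (fun i => (preissWeight i : ℝ)) preissMap where
  antitone i j hij := by exact_mod_cast antitone_preissWeight hij
  pos i := preissWeight_pos i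
  summable := summable_preissWeight
  injective := injective_preissMap
  range_eq := range_preissMap
  norm_eq := norm_eq_preissMap
  measurable := continuous_preissMap.measurable
  map_eq := by
    rw [preissGaussian, measurableEmbedding_preissMap.map_comap,
      Measure.restrict_eq_self_of_ae_mem ae_mem_range_preissMap]

instance : IsProbabilityMeasure preissGaussian :=
  isWeightedGaussianSpace_preissGaussian.isProbabilityMeasure

instance : IsGaussian preissGaussian := by
  refine isGaussian_of_map_eq_gaussianReal fun L => ?_
  -- By Riesz, `L` is the inner product with `a`, that is `∑ bᵢ (T h)ᵢ` with `bᵢ = aᵢ √wᵢ`. Its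
  -- partial sums are Gaussian with variances `∑ bᵢ²`, convergent because `wᵢ ≤ 1`.
  set a : RealEllTwo := (InnerProductSpace.toDual ℝ RealEllTwo).symm L with ha
  set b : ℕ → ℝ := fun i => a i * √(preissWeight i) with hb
  have hL : ∀ h, HasSum (fun i => b i * preissMap h i) (L h) := by
    intro h
    have h1 := lp.hasSum_inner (𝕜 := ℝ) (G := fun _ : ℕ => ℝ) a h
    rw [ha, InnerProductSpace.toDual_symm_apply] at h1
    refine h1.congr_fun fun i => ?_
    have hw : (√(preissWeight i) : ℝ) ≠ 0 := (Real.sqrt_pos.2 (preissWeight_pos i)).ne'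
    rw [preissMap_apply, hb]
    simp only [RCLike.inner_apply, conj_trivial, ← ha]
    field_simp
  have hbs : Summable fun i => (b i ^ 2).toNNReal := by
    rw [← NNReal.summable_coe]
    have h1 := (memℓp_gen_iff (by norm_num)).1 (lp.memℓp a)
    simp only [ENNReal.toReal_ofNat, Real.rpow_ofNat, Real.norm_eq_abs, sq_abs] at h1
    refine h1.of_nonneg_of_le (fun i => NNReal.coe_nonneg _) fun i => ?_
    rw [Real.coe_toNNReal _ (sq_nonneg _), hb, mul_pow, Real.sq_sqrt (NNReal.coe_nonneg _)]
    refine mul_le_of_le_one_right (sq_nonneg _) ?_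
    have := antitone_preissWeight (Nat.zero_le i)
    have h0 : preissWeight 0 = 1 := by simp [preissWeight]
    rw [h0] at this
    exact_mod_cast this
  refine ⟨0, ∑' i, (b i ^ 2).toNNReal, ?_⟩
  have hT := isWeightedGaussianSpace_preissGaussian
  refine map_eq_gaussianReal_of_tendsto
    (X := fun n h => ∑ i ∈ Finset.range n, b i * preissMap h i) (fun n => ?_) (by fun_prop)
    (fun h => (hL h).tendsto_sum_nat) hbs.hasSum.tendsto_sum_nat fun n => ?_
  · have : Measurable fun y : ℕ → ℝ => ∑ i ∈ Finset.range n, b i * y i := by fun_prop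
    exact this.comp hT.measurable
  · rw [← stdGaussianSeq_map_sum, ← hT.map_eq, Measure.map_map (by fun_prop) hT.measurable]
    rfl

theorem not_finiteDimensional_realEllTwo : ¬ FiniteDimensional ℝ RealEllTwo := by
  intro hfin
  have hli : LinearIndependent ℝ fun i => (lp.single 2 i (1 : ℝ) : RealEllTwo) := by
    refine Orthonormal.linearIndependent (𝕜 := ℝ) ?_
    rw [orthonormal_iff_ite]
    intro i j
    rw [lp.inner_single_left]
    simp [lp.single_apply, Pi.single_apply]
  exact not_finite_iff_infinite.2 (inferInstance : Infinite ℕ) hli.finite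

theorem corollary1p4 :
    ∃ (H : Type) (_ : NormedAddCommGroup H) (_ : InnerProductSpace ℝ H) (_ : CompleteSpace H)
      (_ : TopologicalSpace.SeparableSpace H) (_ : MeasurableSpace H) (_ : BorelSpace H)
      (γ : Measure H),
      ¬ FiniteDimensional ℝ H ∧
      IsGaussian γ ∧
      (∃ (w : ℕ → ℝ) (T : H →ₗ[ℝ] (ℕ → ℝ)), IsWeightedGaussianSpace γ w T) ∧
      (∃ f : H → ℝ, LocallyIntegrable f γ ∧
        ∃ A : Set H, MeasurableSet A ∧ 0 < γ A ∧ ∀ x ∈ A, centeredMaximal γ f x < ‖f x‖ₑ) ∧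
      (∀ f : H → ℝ, LocallyIntegrable f γ → IsMaximalFixedPoint γ f →
        ∃ c : ℝ, ∀ᵐ x ∂γ, f x = c) := by
  have : SecondCountableTopology RealEllTwo := UniformSpace.secondCountable_of_separable _
  exact ⟨RealEllTwo, inferInstance, inferInstance, inferInstance, inferInstance, inferInstance,
    inferInstance, preissGaussian, not_finiteDimensional_realEllTwo, inferInstance,
    ⟨_, _, isWeightedGaussianSpace_preissGaussian⟩,
    exists_centeredMaximal_lt isWeightedGaussianSpace_preissGaussian,
    fun f hf hfix => hfix.ae_eq_const hf.aestronglyMeasurable⟩
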